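/- **Definitions.** Manifolds and metrics are smooth. A conformal structure of signature $(p,q)$ on an $n$-manifold $M$, represented by a metric $g$, is viewed as the ray bundle $\pi:\mathcal Q\to M$ whose points are the pairs $(x,s^2g_x)$, $x\in M$, $s>0$, with the $\mathbb R_+$-action $s\cdot(x,g'_x)=(x,s^2g'_x)$. An *ambient manifold* for $(M,[g])$ is a smooth $(n+2)$-manifold $\tilde M$ with a smooth free $\mathbb R_+$-action and an $\mathbb R_+$-equivariant embedding $i:\mathcal Q\to\tilde M$. With $X$ the vector field generating the action, an *ambient metric* on it is a pseudo-Riemannian metric $h$ on $\tilde M$ of signature $(p+1,q+1)$ such that (i) $\mathcal L_Xh=2h$, and (ii) $h(i_*\xi,i_*\eta)=g'_x(\pi_*\xi,\pi_*\eta)$ for all $u=(x,g'_x)\in\mathcal Q$ and $\xi,\eta\in T_u\mathcal Q$. **Theorem 2.1.** Let $(M_1^{m_1},g_1)$ and $(M_2^{m_2},g_2)$, with $m_1\ge1$ and $m_2\ge0$, be pseudo-Riemannian manifolds of signatures $(p_1,q_1)$ and $(p_2,q_2)$ which are Einstein (i.e. $\operatorname{Ric}(g_k)=c_kg_k$ with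 $c_k$ constant), with scalar curvatures satisfying $$m_2(m_2-1)\,\mathrm{Sc}(g_1)=-m_1(m_1-1)\,\mathrm{Sc}(g_2).$$ Let $\mu\in\mathbb R$ satisfy $2m_1(m_1-1)\mu=\mathrm{Sc}(g_1)$ and $2m_2(m_2-1)\mu=-\mathrm{Sc}(g_2)$. Let $\mathcal Q$ be the ray bundle of $(M_1\times M_2,[g_1\times g_2])$, with fibre coordinate $t>0$ given by writing a point as $(x,t^2(g_1\times g_2)_x)$. Put $\tilde I=\mathbb R$ if $\mu=0$, $\tilde I=\mathbb R\setminus\{-1/\mu\}$ if $\mu\ne0$ and $m_2=0$, and $\tilde I=\mathbb R\setminus\{1/\mu,-1/\mu\}$ otherwise, and let $\rho$ be the standard coordinate on $\tilde I$. Let $\mathbb R_+$ act on $\tilde M=\mathcal Q\times\tilde I$ through the first factor, and embed $\mathcal Q$ in $\tilde M$ as $\mathcal Q\times\{0\}$. Then $\tilde M$ is an ambient manifold for $(M_1\times M_2,[g_1\times g_2])$, and $$h=2t\,dt\,d\rho+2\rho\,dt^2+t^2\big[(1+\mu\rho)^2g_1+(1-\mu\rho)^2g_2\big]$$ (where $g_1,g_2$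 are pulled back to $\tilde M$ and $dt\,d\rho$ denotes the symmetric product $\tfrac12(dt\otimes d\rho+d\rho\otimes dt)$) is an ambient metric on it; it has signature $(p_1+p_2+1,q_1+q_2+1)$ and is Ricci-flat. -/

import Mathlib

set_option maxSynthPendingDepth 3

open scoped Manifold ContDiff
open Set TopologicalSpace

noncomputable section

namespace AmbientGeometry

/-! ### Pseudo-Riemannian calculus in a coordinate domain -/

section Local

variable {E : Type*} [NormedAddCommGroup E] [NormedSpace ℝ E]

/-- Christoffel symbols of the first kind of a field `G` of bilinear forms on the vector space `E`:
`[vw, z] = ½ (D_v G (w, z) + D_w G (v, z) - D_z G (v, w))`, as a functional of `z`. -/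
def christoffelFirst (G : E → E →L[ℝ] E →L[ℝ] ℝ) (y : E) : E →L[ℝ] E →L[ℝ] E →L[ℝ] ℝ :=
  (1 / 2 : ℝ) • (fderiv ℝ G y + (fderiv ℝ G y).flip
    - ((ContinuousLinearMap.flipₗᵢ ℝ E E ℝ).toContinuousLinearEquiv :
        (E →L[ℝ] E →L[ℝ] ℝ) →L[ℝ] (E →L[ℝ] E →L[ℝ] ℝ)) ∘L (fderiv ℝ G y).flip)

/-- Christoffel symbols `Γ(v, w)` of the Levi-Civita connection of `G`: the index `z` of
`christoffelFirst` is raised with the inverse of `G y : E → E*`. -/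
def christoffel (G : E → E →L[ℝ] E →L[ℝ] ℝ) (y : E) : E →L[ℝ] E →L[ℝ] E :=
  (ContinuousLinearMap.compL ℝ E (E →L[ℝ] ℝ) E (G y).inverse).comp (christoffelFirst G y)

/-- The endomorphism `u ↦ R(u, v) w`, where
`R(u, v) w = D_u Γ (v, w) - D_v Γ (u, w) + Γ(u, Γ(v, w)) - Γ(v, Γ(u, w))`. -/
def curvatureEnd (G : E → E →L[ℝ] E →L[ℝ] ℝ) (y v w : E) : E →ₗ[ℝ] E where
  toFun u := fderiv ℝ (christoffel G) y u v w - fderiv ℝ (christoffel G) y v u w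
    + christoffel G y u (christoffel G y v w) - christoffel G y v (christoffel G y u w)
  map_add' a b := by
    simp only [map_add, _root_.add_apply]
    abel
  map_smul' c a := by
    simp only [map_smul, _root_.smul_apply, RingHom.id_apply, smul_sub, smul_add]

/-- The Ricci tensor `Ric(v, w) = tr (u ↦ R(u, v) w)` of `G` at `y`. -/
def ricciLocal (G : E → E →L[ℝ] E →L[ℝ] ℝ) (y : E) : LinearMap.BilinForm ℝ E :=
  LinearMap.mk₂ ℝ (fun v w => LinearMap.trace ℝ E (curvatureEnd G y v w))
    (fun a b w => by
      rw [← map_add]; congr 1; ext u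
      simp only [curvatureEnd, map_add, _root_.add_apply, LinearMap.coe_mk,
        AddHom.coe_mk, LinearMap.add_apply]
      abel)
    (fun c a w => by
      rw [← map_smul]; congr 1; ext u
      simp only [curvatureEnd, map_smul, _root_.smul_apply, LinearMap.coe_mk,
        AddHom.coe_mk, LinearMap.smul_apply, smul_sub, smul_add])
    (fun v a b => by
      rw [← map_add]; congr 1; ext u
      simp only [curvatureEnd, map_add, LinearMap.coe_mk,
        AddHom.coe_mk, LinearMap.add_apply]
      abel)
    (fun c v a => by
      rw [← map_smul]; congr 1; ext u
      simp only [curvatureEnd, map_smul, LinearMap.coe_mk,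
        AddHom.coe_mk, LinearMap.smul_apply, smul_sub, smul_add])

/-- The scalar curvature of `G` at `y`: the trace of the Ricci tensor with one index raised. -/
def scalarLocal [FiniteDimensional ℝ E] (G : E → E →L[ℝ] E →L[ℝ] ℝ) (y : E) : ℝ :=
  LinearMap.trace ℝ E ((G y).inverse.toLinearMap ∘ₗ
    (LinearMap.toContinuousLinearMap : (E →ₗ[ℝ] ℝ) ≃ₗ[ℝ] (E →L[ℝ] ℝ)).toLinearMap ∘ₗ
      ricciLocal G y)

end Local

/-! ### Pseudo-Riemannian metrics on manifolds without boundary -/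

section Manifold

variable {E : Type*} [NormedAddCommGroup E] [NormedSpace ℝ E]
  {H : Type*} [TopologicalSpace H] (I : ModelWithCorners ℝ E H)
  (M : Type*) [TopologicalSpace M] [ChartedSpace H M]

/-- Fields of bilinear forms on the tangent spaces (covariant `2`-tensor fields, no smoothness). -/
abbrev BilinField := (x : M) → LinearMap.BilinForm ℝ (TangentSpace I x)

variable {I M}

/-- The pull-back of a field of bilinear forms by a map of manifolds. -/
def pullback {E' : Type*} [NormedAddCommGroup E'] [NormedSpace ℝ E']
    {H' : Type*} [TopologicalSpace H'] {J : ModelWithCorners ℝ E' H'}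
    {N : Type*} [TopologicalSpace N] [ChartedSpace H' N]
    (f : N → M) (g : BilinField I M) : BilinField J N := fun x =>
  (g (f x)).compl₁₂ (mfderiv J I f x).toLinearMap (mfderiv J I f x).toLinearMap

variable [FiniteDimensional ℝ E]

/-- The components of `g` in the preferred chart `φ` at `x`, that is `(φ⁻¹)^* g`, as a field of
bilinear forms on (the target of `φ` in) the model space `E`. -/
def inChart (g : BilinField I M) (x : M) (y : E) : E →L[ℝ] E →L[ℝ] ℝ :=
  LinearMap.toContinuousBilinearMap
    ((pullback (J := 𝓘(ℝ, E)) (extChartAt I x).symm g y : LinearMap.BilinForm ℝ E))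

/-- `g` is a smooth pseudo-Riemannian metric: symmetric, nondegenerate, and with smooth components
in charts. -/
structure IsPseudoMetric (g : BilinField I M) : Prop where
  symm : ∀ x v w, g x v w = g x w v
  nondegenerate : ∀ x v, (∀ w, g x v w = 0) → v = 0
  smooth : ∀ x, ContDiffOn ℝ ∞ (inChart g x) (extChartAt I x).target

/-- `g` has signature `(p, q)` (`p` positive and `q` negative directions) at every point. -/
def HasSignature (g : BilinField I M) (p q : ℕ) : Prop :=
  ∀ x, sigPos (g x).toQuadraticMap = p ∧
    sigNeg (g x).toQuadraticMap = q

/-- The Ricci tensor. The tangent space at `x` is identified with `E` through the preferred chart at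
`x`, which is the identification that `TangentSpace` is built on. -/
def ricci (g : BilinField I M) : BilinField I M := fun x =>
  (ricciLocal (inChart g x) (extChartAt I x x) : LinearMap.BilinForm ℝ E)

/-- The scalar curvature. -/
def scalarCurvature (g : BilinField I M) (x : M) : ℝ :=
  scalarLocal (inChart g x) (extChartAt I x x)

/-- Einstein metrics: `Ric(g) = λ g` for a constant `λ`. -/
def IsEinstein (g : BilinField I M) : Prop :=
  ∃ c : ℝ, ∀ x, ricci g x = c • g x

/-- A vector field in the preferred chart at `x`. -/
def vectorInChart (X : (z : M) → TangentSpace I z) (x : M) (y : E) : E :=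
  (mfderiv I 𝓘(ℝ, E) (extChartAt I x) ((extChartAt I x).symm y) (X ((extChartAt I x).symm y)) : E)

/-- The Lie derivative of a field of bilinear forms along a vector field, in local coordinates:
`(𝓛_X g)(v, w) = (D_X g)(v, w) + g(D_v X, w) + g(v, D_w X)`. -/
def lieDerivative (X : (z : M) → TangentSpace I z) (g : BilinField I M) (x : M)
    (v w : TangentSpace I x) : ℝ :=
  fderiv ℝ (inChart g x) (extChartAt I x x) (vectorInChart X x (extChartAt I x x)) v w
    + inChart g x (extChartAt I x x) (fderiv ℝ (vectorInChart X x) (extChartAt I x x) v) w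
    + inChart g x (extChartAt I x x) v (fderiv ℝ (vectorInChart X x) (extChartAt I x x) w)

variable (I M) in
/-- Bundled pseudo-Riemannian metrics. -/
structure PseudoMetric where
  /-- The bilinear forms on the tangent spaces. -/
  val : BilinField I M
  isPseudoMetric : IsPseudoMetric val

end Manifold

/-! ### Products -/

section Prod

variable {E₁ : Type*} [NormedAddCommGroup E₁] [NormedSpace ℝ E₁]
  {H₁ : Type*} [TopologicalSpace H₁] {I₁ : ModelWithCorners ℝ E₁ H₁}
  {M₁ : Type*} [TopologicalSpace M₁] [ChartedSpace H₁ M₁]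
  {E₂ : Type*} [NormedAddCommGroup E₂] [NormedSpace ℝ E₂]
  {H₂ : Type*} [TopologicalSpace H₂] {I₂ : ModelWithCorners ℝ E₂ H₂}
  {M₂ : Type*} [TopologicalSpace M₂] [ChartedSpace H₂ M₂]

/-- The product field `g₁ × g₂`, that is `pr₁^* g₁ + pr₂^* g₂`. -/
def prodField (g₁ : BilinField I₁ M₁) (g₂ : BilinField I₂ M₂) :
    BilinField (I₁.prod I₂) (M₁ × M₂) := fun x =>
  pullback (J := I₁.prod I₂) Prod.fst g₁ x + pullback (J := I₁.prod I₂) Prod.snd g₂ x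

theorem prodField_apply (g₁ : BilinField I₁ M₁) (g₂ : BilinField I₂ M₂) (x : M₁ × M₂)
    (v w : E₁ × E₂) :
    prodField g₁ g₂ x v w = g₁ x.1 v.1 w.1 + g₂ x.2 v.2 w.2 := by
  simp only [prodField, pullback, mfderiv_fst, mfderiv_snd]
  rfl

variable [FiniteDimensional ℝ E₁] [FiniteDimensional ℝ E₂]
  [I₁.Boundaryless] [I₂.Boundaryless] [IsManifold I₁ ∞ M₁] [IsManifold I₂ ∞ M₂]

theorem inChart_prodField (g₁ : BilinField I₁ M₁) (g₂ : BilinField I₂ M₂) (x : M₁ × M₂)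
    (y : E₁ × E₂) (hy : y ∈ (extChartAt (I₁.prod I₂) x).target) :
    inChart (prodField g₁ g₂) x y =
      (inChart g₁ x.1 y.1).bilinearComp (ContinuousLinearMap.fst ℝ E₁ E₂)
          (ContinuousLinearMap.fst ℝ E₁ E₂) +
        (inChart g₂ x.2 y.2).bilinearComp (ContinuousLinearMap.snd ℝ E₁ E₂)
          (ContinuousLinearMap.snd ℝ E₁ E₂) := by
  rw [extChartAt_prod] at hy
  have d₁ : MDifferentiableAt 𝓘(ℝ, E₁) I₁ (extChartAt I₁ x.1).symm y.1 :=
    ((contMDiffOn_extChartAt_symm (n := ∞) x.1).contMDiffAt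
      ((isOpen_extChartAt_target x.1).mem_nhds hy.1)).mdifferentiableAt (by simp)
  have d₂ : MDifferentiableAt 𝓘(ℝ, E₂) I₂ (extChartAt I₂ x.2).symm y.2 :=
    ((contMDiffOn_extChartAt_symm (n := ∞) x.2).contMDiffAt
      ((isOpen_extChartAt_target x.2).mem_nhds hy.2)).mdifferentiableAt (by simp)
  have f₁ : HasMFDerivAt 𝓘(ℝ, E₁ × E₂) 𝓘(ℝ, E₁) (Prod.fst : E₁ × E₂ → E₁) y
      (ContinuousLinearMap.fst ℝ E₁ E₂) := hasFDerivAt_fst.hasMFDerivAt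
  have f₂ : HasMFDerivAt 𝓘(ℝ, E₁ × E₂) 𝓘(ℝ, E₂) (Prod.snd : E₁ × E₂ → E₂) y
      (ContinuousLinearMap.snd ℝ E₁ E₂) := hasFDerivAt_snd.hasMFDerivAt
  have key := ((d₁.hasMFDerivAt.comp y f₁).prodMk (d₂.hasMFDerivAt.comp y f₂)).mfderiv
  have hφ : ((extChartAt (I₁.prod I₂) x).symm : E₁ × E₂ → M₁ × M₂) =
      fun y => (((extChartAt I₁ x.1).symm ∘ Prod.fst) y, ((extChartAt I₂ x.2).symm ∘ Prod.snd) y) := by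
    rw [extChartAt_prod]; rfl
  rw [← hφ] at key
  refine ContinuousLinearMap.ext fun v => ContinuousLinearMap.ext fun w => ?_
  have e : ∀ u : E₁ × E₂, (mfderiv 𝓘(ℝ, E₁ × E₂) (I₁.prod I₂)
      (extChartAt (I₁.prod I₂) x).symm y u : E₁ × E₂) =
      (mfderiv 𝓘(ℝ, E₁) I₁ (extChartAt I₁ x.1).symm y.1 u.1,
        mfderiv 𝓘(ℝ, E₂) I₂ (extChartAt I₂ x.2).symm y.2 u.2) := fun u =>
    congrArg (fun L : E₁ × E₂ →L[ℝ] E₁ × E₂ => L u) key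
  have hb : (extChartAt (I₁.prod I₂) x).symm y =
      ((extChartAt I₁ x.1).symm y.1, (extChartAt I₂ x.2).symm y.2) := by
    rw [hφ]; rfl
  refine (prodField_apply g₁ g₂ _ _ _).trans ?_
  refine (congrArg₂ (fun a b : E₁ × E₂ => g₁ ((extChartAt (I₁.prod I₂) x).symm y).1 a.1 b.1 +
    g₂ ((extChartAt (I₁.prod I₂) x).symm y).2 a.2 b.2) (e v) (e w)).trans ?_
  exact congrArg (fun z : M₁ × M₂ => g₁ z.1
      (mfderiv 𝓘(ℝ, E₁) I₁ (extChartAt I₁ x.1).symm y.1 v.1 : E₁)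
      (mfderiv 𝓘(ℝ, E₁) I₁ (extChartAt I₁ x.1).symm y.1 w.1 : E₁) +
    g₂ z.2 (mfderiv 𝓘(ℝ, E₂) I₂ (extChartAt I₂ x.2).symm y.2 v.2 : E₂)
      (mfderiv 𝓘(ℝ, E₂) I₂ (extChartAt I₂ x.2).symm y.2 w.2 : E₂)) hb

/-- The product metric `g₁ × g₂`. -/
def PseudoMetric.prod (g₁ : PseudoMetric I₁ M₁) (g₂ : PseudoMetric I₂ M₂) :
    PseudoMetric (I₁.prod I₂) (M₁ × M₂) where
  val := prodField g₁.val g₂.val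
  isPseudoMetric :=
    { symm := fun x v w => by
        refine (prodField_apply g₁.val g₂.val x v w).trans
          (Eq.trans ?_ (prodField_apply g₁.val g₂.val x w v).symm)
        exact congrArg₂ (· + ·) (g₁.isPseudoMetric.symm _ _ _) (g₂.isPseudoMetric.symm _ _ _)
      nondegenerate := fun x v hv => by
        have h₁ : (v : E₁ × E₂).1 = 0 := by
          refine g₁.isPseudoMetric.nondegenerate x.1 _ fun w => ?_
          have := (prodField_apply g₁.val g₂.val x v (w, 0)).symm.trans (hv _)
          exact (add_zero _).symm.trans
            ((congrArg (_ + ·) (map_zero (g₂.val x.2 (v : E₁ × E₂).2)).symm).trans this)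
        have h₂ : (v : E₁ × E₂).2 = 0 := by
          refine g₂.isPseudoMetric.nondegenerate x.2 _ fun w => ?_
          have := (prodField_apply g₁.val g₂.val x v (0, w)).symm.trans (hv _)
          exact (zero_add _).symm.trans
            ((congrArg (· + _) (map_zero (g₁.val x.1 (v : E₁ × E₂).1)).symm).trans this)
        exact Prod.ext h₁ h₂
      smooth := fun x => by
        refine ContDiffOn.congr ?_ (inChart_prodField g₁.val g₂.val x)
        rw [extChartAt_prod]
        have s₁ := (g₁.isPseudoMetric.smooth x.1).comp
          (contDiff_fst (𝕜 := ℝ) (E := E₁) (F := E₂)).contDiffOn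
          (fun (y : E₁ × E₂) (hy : y ∈ ((extChartAt I₁ x.1).prod (extChartAt I₂ x.2)).target) => hy.1)
        have s₂ := (g₂.isPseudoMetric.smooth x.2).comp
          (contDiff_snd (𝕜 := ℝ) (E := E₁) (F := E₂)).contDiffOn
          (fun (y : E₁ × E₂) (hy : y ∈ ((extChartAt I₁ x.1).prod (extChartAt I₂ x.2)).target) => hy.2)
        have c₁ : ContDiff ℝ ∞ (fun B : E₁ →L[ℝ] E₁ →L[ℝ] ℝ => B.bilinearComp
            (ContinuousLinearMap.fst ℝ E₁ E₂) (ContinuousLinearMap.fst ℝ E₁ E₂)) :=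
          (ContinuousLinearMap.flipₗᵢ ℝ (E₁ × E₂) (E₁ × E₂) ℝ).contDiff.comp
            (((ContinuousLinearMap.flipₗᵢ ℝ (E₁ × E₂) E₁ ℝ).contDiff.comp
              (contDiff_id.clm_comp contDiff_const)).clm_comp contDiff_const)
        have c₂ : ContDiff ℝ ∞ (fun B : E₂ →L[ℝ] E₂ →L[ℝ] ℝ => B.bilinearComp
            (ContinuousLinearMap.snd ℝ E₁ E₂) (ContinuousLinearMap.snd ℝ E₁ E₂)) :=
          (ContinuousLinearMap.flipₗᵢ ℝ (E₁ × E₂) (E₁ × E₂) ℝ).contDiff.comp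
            (((ContinuousLinearMap.flipₗᵢ ℝ (E₁ × E₂) E₂ ℝ).contDiff.comp
              (contDiff_id.clm_comp contDiff_const)).clm_comp contDiff_const)
        exact (c₁.comp_contDiffOn s₁).add (c₂.comp_contDiffOn s₂) }

end Prod

/-! ### The ray bundle of a conformal structure -/

section Rays

/-- The multiplicative group `ℝ₊` of positive real numbers, an open submanifold of `ℝ`. -/
abbrev PosReal : Type := {s : ℝ // 0 < s}

instance : ChartedSpace ℝ PosReal :=
  inferInstanceAs (ChartedSpace ℝ (⟨Ioi 0, isOpen_Ioi⟩ : Opens ℝ))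

instance : IsManifold 𝓘(ℝ, ℝ) ∞ PosReal :=
  inferInstanceAs (IsManifold 𝓘(ℝ, ℝ) ∞ (⟨Ioi 0, isOpen_Ioi⟩ : Opens ℝ))

variable {E : Type*} [NormedAddCommGroup E] [NormedSpace ℝ E] [FiniteDimensional ℝ E]
  {H : Type*} [TopologicalSpace H] {I : ModelWithCorners ℝ E H}
  {M : Type*} [TopologicalSpace M] [ChartedSpace H M]

/-- The bundle `𝒬 ⊂ S²T*M` of the conformal structure `[g]`: its points are the pairs `(x, g'_x)`
where `g'_x` is a bilinear form on `T_x M` which is a positive multiple of `g_x`. -/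
@[ext]
structure RayBundle (g : PseudoMetric I M) where
  /-- The bundle projection `π : 𝒬 → M`. -/
  base : M
  /-- The metric `g'_x` on `T_x M`. -/
  form : LinearMap.BilinForm ℝ (TangentSpace I base)
  exists_form_eq : ∃ s : PosReal, form = (s : ℝ) ^ 2 • g.val base

namespace RayBundle

variable {g : PseudoMetric I M}

/-- The fibre coordinate `t > 0` on `𝒬` determined by `g`: the point is `(x, t² g_x)`. -/
def scale (u : RayBundle g) : PosReal := u.exists_form_eq.choose

theorem form_eq (u : RayBundle g) : u.form = (u.scale : ℝ) ^ 2 • g.val u.base :=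
  u.exists_form_eq.choose_spec

/-- The action of `ℝ₊` on `𝒬`, `s · (x, g'_x) = (x, s² g'_x)`. -/
def dilate (s : PosReal) (u : RayBundle g) : RayBundle g where
  base := u.base
  form := (s : ℝ) ^ 2 • u.form
  exists_form_eq := ⟨s * u.scale, by rw [u.form_eq, smul_smul, ← mul_pow]; rfl⟩

variable [Nontrivial E]

theorem _root_.AmbientGeometry.PseudoMetric.val_ne_zero (g : PseudoMetric I M) (x : M) :
    g.val x ≠ 0 := by
  intro h
  obtain ⟨v, hv⟩ := exists_ne (0 : E)
  exact hv (g.isPseudoMetric.nondegenerate x v fun w => by rw [h]; rfl)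

theorem scale_eq (u : RayBundle g) (s : PosReal) (h : u.form = (s : ℝ) ^ 2 • g.val u.base) :
    u.scale = s := by
  rw [u.form_eq] at h
  have := smul_left_injective ℝ (g.val_ne_zero u.base) h
  exact Subtype.ext ((pow_left_inj₀ u.scale.2.le s.2.le two_ne_zero).1 this)

/-- The trivialisation of `𝒬` by the metric `g`: `(x, t² g_x) ↔ (x, t)`. -/
def equiv (g : PseudoMetric I M) : RayBundle g ≃ M × PosReal where
  toFun u := (u.base, u.scale)
  invFun z := ⟨z.1, (z.2 : ℝ) ^ 2 • g.val z.1, z.2, rfl⟩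
  left_inv u := by
    obtain ⟨x, b, hb⟩ := u
    simp only [RayBundle.mk.injEq, true_and]
    exact (form_eq ⟨x, b, hb⟩).symm
  right_inv z := Prod.ext rfl (scale_eq _ _ rfl)

/-- `𝒬` has the topology, and below the smooth structure, for which the trivialisation
`(x, t² g_x) ↦ (x, t)` is a diffeomorphism. -/
instance : TopologicalSpace (RayBundle g) := TopologicalSpace.induced (equiv g) inferInstance

/-- The trivialisation as a homeomorphism. -/
def homeo (g : PseudoMetric I M) : RayBundle g ≃ₜ M × PosReal :=
  (equiv g).toHomeomorphOfIsInducing ⟨rfl⟩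

instance : ChartedSpace (ModelProd H ℝ) (RayBundle g) where
  atlas := {e | ∃ c ∈ atlas (ModelProd H ℝ) (M × PosReal),
    e = (homeo g).toOpenPartialHomeomorph ≫ₕ c}
  chartAt u := (homeo g).toOpenPartialHomeomorph ≫ₕ chartAt (ModelProd H ℝ) (homeo g u)
  mem_chart_source u := by simp
  chart_mem_atlas u := ⟨_, chart_mem_atlas _ _, rfl⟩

instance [IsManifold I ∞ M] : IsManifold (I.prod 𝓘(ℝ, ℝ)) ∞ (RayBundle g) where
  compatible := by
    rintro _ _ ⟨c, hc, rfl⟩ ⟨c', hc', rfl⟩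
    have h : c.symm ≫ₕ c' ∈ contDiffGroupoid ∞ (I.prod 𝓘(ℝ, ℝ)) :=
      HasGroupoid.compatible hc hc'
    refine (contDiffGroupoid ∞ (I.prod 𝓘(ℝ, ℝ))).mem_of_eqOnSource h ?_
    constructor
    · ext y
      simp
    · intro y _
      simp

end RayBundle

end Rays

/-! ### Ambient manifolds and ambient metrics -/

section Ambient

variable {E : Type*} [NormedAddCommGroup E] [NormedSpace ℝ E] [FiniteDimensional ℝ E]
  [Nontrivial E] {H : Type*} [TopologicalSpace H] {I : ModelWithCorners ℝ E H}
  {M : Type*} [TopologicalSpace M] [ChartedSpace H M] [IsManifold I ∞ M]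
  {E' : Type*} [NormedAddCommGroup E'] [NormedSpace ℝ E'] [FiniteDimensional ℝ E']
  {H' : Type*} [TopologicalSpace H'] (J : ModelWithCorners ℝ E' H')
  {N : Type*} [TopologicalSpace N] [ChartedSpace H' N] [IsManifold J ∞ N]

/-- The fundamental vector field `X(u) = d/ds (e^s · u)` at `s = 0` of an action of `ℝ₊`. -/
def fundamentalField (act : PosReal → N → N) (u : N) : TangentSpace J u :=
  (mfderiv 𝓘(ℝ, ℝ) J (fun s : ℝ => act ⟨Real.exp s, Real.exp_pos s⟩ u) 0 (1 : ℝ) : E')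

/-- `N`, with the action `act` of `ℝ₊` and the map `i : 𝒬 → N`, is an ambient manifold for the
conformal manifold `(M, [g])`. -/
structure IsAmbientManifold (g : PseudoMetric I M) (act : PosReal → N → N)
    (i : RayBundle g → N) : Prop where
  finrank_eq : Module.finrank ℝ E' = Module.finrank ℝ E + 2
  one_act : ∀ u, act 1 u = u
  mul_act : ∀ s s' u, act (s * s') u = act s (act s' u)
  free : ∀ s u, act s u = u → s = 1
  smooth_act : ContMDiff (𝓘(ℝ, ℝ).prod J) J ∞ (fun z : PosReal × N => act z.1 z.2)
  embedding : Manifold.IsSmoothEmbedding (I.prod 𝓘(ℝ, ℝ)) J ∞ i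
  equivariant : ∀ s u, i (u.dilate s) = act s (i u)

/-- `h` is an ambient metric on the ambient manifold `(N, act, i)` for the conformal manifold
`(M, [g])` of signature `(p, q)`. -/
structure IsAmbientMetric (g : PseudoMetric I M) (p q : ℕ) (act : PosReal → N → N)
    (i : RayBundle g → N) (h : BilinField J N) : Prop where
  isPseudoMetric : IsPseudoMetric h
  hasSignature : HasSignature h (p + 1) (q + 1)
  /-- `𝓛_X h = 2 h` for the fundamental field `X`. -/
  homogeneous : ∀ u v w, lieDerivative (fundamentalField J act) h u v w = 2 * h u v w
  /-- `i^* h` is the tautological form: `h(i_* ξ, i_* η) = g'_x(π_* ξ, π_* η)` at `(x, g'_x)`. -/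
  tautological : ∀ (u : RayBundle g) (ξ η : TangentSpace (I.prod 𝓘(ℝ, ℝ)) u),
    h (i u) (mfderiv (I.prod 𝓘(ℝ, ℝ)) J i u ξ) (mfderiv (I.prod 𝓘(ℝ, ℝ)) J i u η) =
      u.form (mfderiv (I.prod 𝓘(ℝ, ℝ)) I RayBundle.base u ξ)
        (mfderiv (I.prod 𝓘(ℝ, ℝ)) I RayBundle.base u η)

end Ambient

/-! ### The explicit metric -/

section Explicit

/-- The open set `Ĩ ⊆ ℝ`. -/
def ambientInterval (m₂ : ℕ) (μ : ℝ) : Opens ℝ :=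
  if μ = 0 then ⊤
  else if m₂ = 0 then ⟨{-1 / μ}ᶜ, isOpen_compl_singleton⟩
  else ⟨{1 / μ, -1 / μ}ᶜ, (Set.toFinite _).isClosed.isOpen_compl⟩

theorem zero_mem_ambientInterval (m₂ : ℕ) (μ : ℝ) : (0 : ℝ) ∈ ambientInterval m₂ μ := by
  unfold ambientInterval
  split_ifs with h₁ h₂
  · trivial
  · change (0 : ℝ) ∉ ({-1 / μ} : Set ℝ)
    simpa using (div_ne_zero (neg_ne_zero.2 one_ne_zero) h₁).symm
  · change (0 : ℝ) ∉ ({1 / μ, -1 / μ} : Set ℝ)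
    simpa [eq_comm (a := (0 : ℝ)) (b := μ), h₁] using
      (div_ne_zero (neg_ne_zero.2 one_ne_zero) h₁).symm

/-- The symmetric product `α β = ½ (α ⊗ β + β ⊗ α)` of two covectors. -/
def symProd {V : Type*} [AddCommGroup V] [Module ℝ V] (α β : V →ₗ[ℝ] ℝ) : LinearMap.BilinForm ℝ V :=
  (1 / 2 : ℝ) • (LinearMap.BilinForm.linMulLin α β + LinearMap.BilinForm.linMulLin β α)

variable {E₁ : Type*} [NormedAddCommGroup E₁] [NormedSpace ℝ E₁] [FiniteDimensional ℝ E₁]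
  [Nontrivial E₁]
  {H₁ : Type*} [TopologicalSpace H₁] {I₁ : ModelWithCorners ℝ E₁ H₁} [I₁.Boundaryless]
  {M₁ : Type*} [TopologicalSpace M₁] [ChartedSpace H₁ M₁] [IsManifold I₁ ∞ M₁]
  {E₂ : Type*} [NormedAddCommGroup E₂] [NormedSpace ℝ E₂] [FiniteDimensional ℝ E₂]
  {H₂ : Type*} [TopologicalSpace H₂] {I₂ : ModelWithCorners ℝ E₂ H₂} [I₂.Boundaryless]
  {M₂ : Type*} [TopologicalSpace M₂] [ChartedSpace H₂ M₂] [IsManifold I₂ ∞ M₂]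

variable (g₁ : PseudoMetric I₁ M₁) (g₂ : PseudoMetric I₂ M₂) (m₂ : ℕ) (μ : ℝ)

/-- The manifold `𝒬 × Ĩ`, where `𝒬` is the ray bundle of `[g₁ × g₂]`. -/
abbrev AmbientSpace : Type _ := RayBundle (g₁.prod g₂) × ambientInterval m₂ μ

variable (I₁ I₂) in
/-- The model with corners (without boundary) of `𝒬 × Ĩ`. -/
abbrev ambientModel : ModelWithCorners ℝ (((E₁ × E₂) × ℝ) × ℝ)
    (ModelProd (ModelProd (ModelProd H₁ H₂) ℝ) ℝ) :=
  ((I₁.prod I₂).prod 𝓘(ℝ, ℝ)).prod 𝓘(ℝ, ℝ)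

/-- The `ℝ₊`-action on `𝒬 × Ĩ`, extending the one of `𝒬` trivially. -/
def ambientAction (s : PosReal) (z : AmbientSpace g₁ g₂ m₂ μ) : AmbientSpace g₁ g₂ m₂ μ :=
  (z.1.dilate s, z.2)

/-- The inclusion of `𝒬` as `𝒬 × {0}`. -/
def ambientInclusion (u : RayBundle (g₁.prod g₂)) : AmbientSpace g₁ g₂ m₂ μ :=
  (u, ⟨0, zero_mem_ambientInterval m₂ μ⟩)

/-- The metric `2 t dt dρ + 2 ρ dt² + t² [(1 + μρ)² g₁ + (1 - μρ)² g₂]` on `𝒬 × Ĩ`. -/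
def ambientMetric :
    BilinField (ambientModel I₁ I₂) (AmbientSpace g₁ g₂ m₂ μ) := fun z =>
  let t : AmbientSpace g₁ g₂ m₂ μ → ℝ := fun z => z.1.scale
  let ρ : AmbientSpace g₁ g₂ m₂ μ → ℝ := fun z => z.2
  let dt := (mvfderiv (ambientModel I₁ I₂) t z).toLinearMap
  let dρ := (mvfderiv (ambientModel I₁ I₂) ρ z).toLinearMap
  (2 * t z) • symProd dt dρ + (2 * ρ z) • symProd dt dt
    + t z ^ 2 • ((1 + μ * ρ z) ^ 2 • pullback (fun z => z.1.base.1) g₁.val z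
      + (1 - μ * ρ z) ^ 2 • pullback (fun z => z.1.base.2) g₂.val z)

end Explicit

end AmbientGeometry

end

open AmbientGeometry

noncomputable section

namespace AmbientGeometry

open Filter Topology

/-! ### The Levi-Civita connection in a coordinate domain -/

section Local

variable {E : Type*} [NormedAddCommGroup E] [NormedSpace ℝ E]

theorem christoffelFirst_apply (G : E → E →L[ℝ] E →L[ℝ] ℝ) (y v w z : E) :
    christoffelFirst G y v w z =
      1 / 2 * (fderiv ℝ G y v w z + fderiv ℝ G y w v z - fderiv ℝ G y z v w) := by
  simp only [christoffelFirst, FunLike.coe_smul, Pi.smul_apply, _root_.sub_apply,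
    _root_.add_apply, ContinuousLinearMap.flip_apply, ContinuousLinearMap.comp_apply,
    ContinuousLinearEquiv.coe_coe, smul_eq_mul]
  rfl

/-- Symmetric nondegenerate and smooth fields of bilinear forms near a point of a vector space. -/
structure IsMetricNear (G : E → E →L[ℝ] E →L[ℝ] ℝ) (y₀ : E) : Prop where
  symm : ∀ᶠ y in 𝓝 y₀, ∀ v w, G y v w = G y w v
  nondegenerate : ∀ᶠ y in 𝓝 y₀, ∀ v, (∀ w, G y v w = 0) → v = 0
  smooth : ∀ᶠ y in 𝓝 y₀, ContDiffAt ℝ ∞ G y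

theorem IsMetricNear.eventually {G : E → E →L[ℝ] E →L[ℝ] ℝ} {y₀ : E} (h : IsMetricNear G y₀) :
    ∀ᶠ y in 𝓝 y₀, IsMetricNear G y := by
  filter_upwards [h.symm.eventually_nhds, h.nondegenerate.eventually_nhds,
    h.smooth.eventually_nhds] with y h₁ h₂ h₃ using ⟨h₁, h₂, h₃⟩

theorem IsMetricNear.differentiableAt {G : E → E →L[ℝ] E →L[ℝ] ℝ} {y : E}
    (h : IsMetricNear G y) : DifferentiableAt ℝ G y :=
  h.smooth.self_of_nhds.differentiableAt (by simp)

theorem hasFDerivAt_bilin_apply {F : Type*} [NormedAddCommGroup F] [NormedSpace ℝ F]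
    {G : E → E →L[ℝ] E →L[ℝ] F} {y : E} (h : DifferentiableAt ℝ G y) (v w : E) :
    HasFDerivAt (fun y => G y v w)
      ((ContinuousLinearMap.apply ℝ F w).comp
        ((ContinuousLinearMap.apply ℝ (E →L[ℝ] F) v).comp (fderiv ℝ G y))) y :=
  (ContinuousLinearMap.apply ℝ F w).hasFDerivAt.comp y
    ((ContinuousLinearMap.apply ℝ (E →L[ℝ] F) v).hasFDerivAt.comp y h.hasFDerivAt)

theorem fderiv_bilin_apply {F : Type*} [NormedAddCommGroup F] [NormedSpace ℝ F]
    {G : E → E →L[ℝ] E →L[ℝ] F} {y : E} (h : DifferentiableAt ℝ G y)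
    (u v w : E) : fderiv ℝ (fun y => G y v w) y u = fderiv ℝ G y u v w := by
  rw [(hasFDerivAt_bilin_apply h v w).fderiv]; rfl

/-- The derivative of a field of bilinear maps along a line, evaluated on two vectors. -/
theorem hasDerivAt_bilin_line {F : Type*} [NormedAddCommGroup F] [NormedSpace ℝ F]
    {G : E → E →L[ℝ] E →L[ℝ] F} {y : E} (h : DifferentiableAt ℝ G y)
    (u v w : E) : HasDerivAt (fun s : ℝ => G (y + s • u) v w) (fderiv ℝ G y u v w) 0 := by
  have h₂ : HasDerivAt (fun s : ℝ => y + s • u) u 0 := by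
    simpa using ((hasDerivAt_id (0 : ℝ)).smul_const u).const_add y
  exact (hasFDerivAt_bilin_apply h v w).comp_hasDerivAt_of_eq (0 : ℝ) h₂ (by simp)

theorem IsMetricNear.fderiv_symm {G : E → E →L[ℝ] E →L[ℝ] ℝ} {y : E}
    (h : IsMetricNear G y) (u v w : E) : fderiv ℝ G y u v w = fderiv ℝ G y u w v := by
  rw [← fderiv_bilin_apply h.differentiableAt, ← fderiv_bilin_apply h.differentiableAt]
  congr 1
  exact Filter.EventuallyEq.fderiv_eq (by filter_upwards [h.symm] with y hy using hy v w)

theorem curvatureEnd_apply (G : E → E →L[ℝ] E →L[ℝ] ℝ) (y v w u : E) :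
    curvatureEnd G y v w u = fderiv ℝ (christoffel G) y u v w - fderiv ℝ (christoffel G) y v u w
    + christoffel G y u (christoffel G y v w) - christoffel G y v (christoffel G y u w) := rfl

theorem ricciLocal_congr {G G' : E → E →L[ℝ] E →L[ℝ] ℝ} {y : E} (h : G =ᶠ[𝓝 y] G') :
    ricciLocal G y = ricciLocal G' y := by
  have hc : christoffel G =ᶠ[𝓝 y] christoffel G' := by
    filter_upwards [h.eventuallyEq_nhds] with z hz
    simp only [christoffel, christoffelFirst, hz.eq_of_nhds, hz.fderiv_eq]
  have he : curvatureEnd G y = curvatureEnd G' y := by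
    funext v w
    ext u
    simp only [curvatureEnd_apply, hc.eq_of_nhds, hc.fderiv_eq]
  refine LinearMap.ext fun v => LinearMap.ext fun w => ?_
  change LinearMap.trace ℝ E (curvatureEnd G y v w) = LinearMap.trace ℝ E (curvatureEnd G' y v w)
  rw [he]

variable [FiniteDimensional ℝ E]

theorem isInvertible_of_nondegenerate {B : E →L[ℝ] E →L[ℝ] ℝ}
    (h : ∀ v, (∀ w, B v w = 0) → v = 0) : B.IsInvertible := by
  have hinj : Function.Injective (B : E →ₗ[ℝ] E →L[ℝ] ℝ) := by
    rw [← LinearMap.ker_eq_bot, LinearMap.ker_eq_bot']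
    intro v hv
    exact h v fun w => by
      have := congrArg (fun L : E →L[ℝ] ℝ => L w) hv
      simpa using this
  have hfin : Module.finrank ℝ E = Module.finrank ℝ (E →L[ℝ] ℝ) := by
    rw [← (LinearMap.toContinuousLinearMap : (E →ₗ[ℝ] ℝ) ≃ₗ[ℝ] (E →L[ℝ] ℝ)).finrank_eq]
    exact (Subspace.dual_finrank_eq (K := ℝ) (V := E)).symm
  refine ⟨(LinearMap.linearEquivOfInjective _ hinj hfin).toContinuousLinearEquiv, ?_⟩
  ext v w
  rfl

theorem IsMetricNear.isInvertible {G : E → E →L[ℝ] E →L[ℝ] ℝ} {y : E}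
    (h : IsMetricNear G y) : (G y).IsInvertible :=
  isInvertible_of_nondegenerate h.nondegenerate.self_of_nhds

theorem IsMetricNear.christoffel_apply_eq_iff {G : E → E →L[ℝ] E →L[ℝ] ℝ} {y : E}
    (h : IsMetricNear G y) {v w x : E} :
    christoffel G y v w = x ↔ ∀ z, christoffelFirst G y v w z = G y x z := by
  change (G y).inverse (christoffelFirst G y v w) = x ↔ _
  rw [h.isInvertible.inverse_apply_eq]
  exact ContinuousLinearMap.ext_iff

theorem IsMetricNear.apply_christoffel {G : E → E →L[ℝ] E →L[ℝ] ℝ} {y : E}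
    (h : IsMetricNear G y) (v w z : E) :
    G y (christoffel G y v w) z =
      1 / 2 * (fderiv ℝ G y v w z + fderiv ℝ G y w v z - fderiv ℝ G y z v w) := by
  rw [← christoffelFirst_apply, (h.christoffel_apply_eq_iff.1 rfl z)]

theorem IsMetricNear.christoffel_symm {G : E → E →L[ℝ] E →L[ℝ] ℝ} {y : E}
    (h : IsMetricNear G y) (v w : E) : christoffel G y v w = christoffel G y w v := by
  rw [h.christoffel_apply_eq_iff]
  intro z
  rw [christoffelFirst_apply, h.apply_christoffel, h.fderiv_symm z v w]
  ring

theorem IsMetricNear.differentiableAt_christoffel {G : E → E →L[ℝ] E →L[ℝ] ℝ} {y : E}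
    (h : IsMetricNear G y) : DifferentiableAt ℝ (christoffel G) y := by
  have := FiniteDimensional.complete ℝ E
  have hG : ContDiffAt ℝ ∞ G y := h.smooth.self_of_nhds
  have hD : DifferentiableAt ℝ (fderiv ℝ G) y :=
    (hG.fderiv_right (m := 1) (by norm_cast)).differentiableAt (by simp)
  have hinv : DifferentiableAt ℝ (fun y => (G y).inverse) y :=
    ((h.isInvertible.contDiffAt_map_inverse (n := 1)).comp y
      (hG.of_le (by norm_cast))).differentiableAt (by simp)
  have hflip : DifferentiableAt ℝ (fun y => (fderiv ℝ G y).flip) y :=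
    (ContinuousLinearMap.flipₗᵢ ℝ E E (E →L[ℝ] ℝ)).differentiable.differentiableAt.comp y hD
  have hfirst : DifferentiableAt ℝ (christoffelFirst G) y := by
    unfold christoffelFirst
    exact ((hD.add hflip).sub ((differentiableAt_const _).clm_comp hflip)).const_smul (1 / 2 : ℝ)
  exact ((ContinuousLinearMap.compL ℝ E (E →L[ℝ] ℝ) E).differentiable.differentiableAt.comp y
    hinv).clm_comp hfirst

/-- The trace of an endomorphism of a product is the sum of the traces of the diagonal blocks. -/
theorem trace_prod {A B : Type*} [AddCommGroup A] [Module ℝ A] [AddCommGroup B] [Module ℝ B]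
    [FiniteDimensional ℝ A] [FiniteDimensional ℝ B] (f : A × B →ₗ[ℝ] A × B) :
    LinearMap.trace ℝ (A × B) f =
      LinearMap.trace ℝ A (LinearMap.fst ℝ A B ∘ₗ f ∘ₗ LinearMap.inl ℝ A B) +
        LinearMap.trace ℝ B (LinearMap.snd ℝ A B ∘ₗ f ∘ₗ LinearMap.inr ℝ A B) := by
  have hf : f = LinearMap.inl ℝ A B ∘ₗ (LinearMap.fst ℝ A B ∘ₗ f) +
      LinearMap.inr ℝ A B ∘ₗ (LinearMap.snd ℝ A B ∘ₗ f) := by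
    ext x <;> simp
  conv_lhs => rw [hf]
  rw [map_add, LinearMap.trace_comp_comm' _ (LinearMap.inl ℝ A B),
    LinearMap.trace_comp_comm' _ (LinearMap.inr ℝ A B)]
  rfl

theorem trace_real (f : ℝ →ₗ[ℝ] ℝ) : LinearMap.trace ℝ ℝ f = f 1 := by
  have : f = (f 1) • LinearMap.id := by ext; simp
  conv_lhs => rw [this]
  simp

theorem trace_rank_one (a : E →ₗ[ℝ] ℝ) (v : E) :
    LinearMap.trace ℝ E (a.smulRight v) = a v := by
  simp

end Local

/-! ### The explicit metric in a coordinate domain -/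

section AmbientForm

variable {E₁ : Type*} [NormedAddCommGroup E₁] [NormedSpace ℝ E₁]
  {E₂ : Type*} [NormedAddCommGroup E₂] [NormedSpace ℝ E₂]

variable (E₁ E₂) in
/-- The projection to the coordinate `t`. -/
def tProj : ((E₁ × E₂) × ℝ) × ℝ →L[ℝ] ℝ :=
  (ContinuousLinearMap.snd ℝ (E₁ × E₂) ℝ).comp (ContinuousLinearMap.fst ℝ ((E₁ × E₂) × ℝ) ℝ)

variable (E₁ E₂) in
/-- The projection to the coordinate `ρ`. -/
def rhoProj : ((E₁ × E₂) × ℝ) × ℝ →L[ℝ] ℝ := ContinuousLinearMap.snd ℝ ((E₁ × E₂) × ℝ) ℝ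

variable (E₁ E₂) in
/-- The projection to the coordinates of the first factor. -/
def fstProj : ((E₁ × E₂) × ℝ) × ℝ →L[ℝ] E₁ :=
  (ContinuousLinearMap.fst ℝ E₁ E₂).comp
    ((ContinuousLinearMap.fst ℝ (E₁ × E₂) ℝ).comp (ContinuousLinearMap.fst ℝ ((E₁ × E₂) × ℝ) ℝ))

variable (E₁ E₂) in
/-- The projection to the coordinates of the second factor. -/
def sndProj : ((E₁ × E₂) × ℝ) × ℝ →L[ℝ] E₂ :=
  (ContinuousLinearMap.snd ℝ E₁ E₂).comp
    ((ContinuousLinearMap.fst ℝ (E₁ × E₂) ℝ).comp (ContinuousLinearMap.fst ℝ ((E₁ × E₂) × ℝ) ℝ))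

@[simp] theorem tProj_apply (y : ((E₁ × E₂) × ℝ) × ℝ) : tProj E₁ E₂ y = y.1.2 := rfl
@[simp] theorem rhoProj_apply (y : ((E₁ × E₂) × ℝ) × ℝ) : rhoProj E₁ E₂ y = y.2 := rfl
@[simp] theorem fstProj_apply (y : ((E₁ × E₂) × ℝ) × ℝ) : fstProj E₁ E₂ y = y.1.1.1 := rfl
@[simp] theorem sndProj_apply (y : ((E₁ × E₂) × ℝ) × ℝ) : sndProj E₁ E₂ y = y.1.1.2 := rfl

variable (μ : ℝ) (G₁ : E₁ → E₁ →L[ℝ] E₁ →L[ℝ] ℝ) (G₂ : E₂ → E₂ →L[ℝ] E₂ →L[ℝ] ℝ)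

/-- The metric `2 t dt dρ + 2 ρ dt² + t² [(1 + μρ)² G₁ + (1 - μρ)² G₂]` on a coordinate domain,
with coordinates `(((x₁, x₂), t), ρ)`. -/
def ambientForm (y : ((E₁ × E₂) × ℝ) × ℝ) :
    ((E₁ × E₂) × ℝ) × ℝ →L[ℝ] ((E₁ × E₂) × ℝ) × ℝ →L[ℝ] ℝ :=
  y.1.2 • ((tProj E₁ E₂).smulRight (rhoProj E₁ E₂) + (rhoProj E₁ E₂).smulRight (tProj E₁ E₂))
    + (2 * y.2) • (tProj E₁ E₂).smulRight (tProj E₁ E₂)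
    + (y.1.2 ^ 2 * (1 + μ * y.2) ^ 2) •
        (G₁ y.1.1.1).bilinearComp (fstProj E₁ E₂) (fstProj E₁ E₂)
    + (y.1.2 ^ 2 * (1 - μ * y.2) ^ 2) •
        (G₂ y.1.1.2).bilinearComp (sndProj E₁ E₂) (sndProj E₁ E₂)

theorem ambientForm_apply (y v w : ((E₁ × E₂) × ℝ) × ℝ) :
    ambientForm μ G₁ G₂ y v w =
      y.1.2 * (v.1.2 * w.2 + v.2 * w.1.2) + 2 * y.2 * (v.1.2 * w.1.2)
      + y.1.2 ^ 2 * (1 + μ * y.2) ^ 2 * G₁ y.1.1.1 v.1.1.1 w.1.1.1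
      + y.1.2 ^ 2 * (1 - μ * y.2) ^ 2 * G₂ y.1.1.2 v.1.1.2 w.1.1.2 := by
  simp [ambientForm, ContinuousLinearMap.bilinearComp_apply, mul_add]

theorem contDiff_bilinearComp {V W : Type*} [NormedAddCommGroup V] [NormedSpace ℝ V]
    [NormedAddCommGroup W] [NormedSpace ℝ W] (L : V →L[ℝ] W) :
    ContDiff ℝ ∞ (fun B : W →L[ℝ] W →L[ℝ] ℝ => B.bilinearComp L L) :=
  (ContinuousLinearMap.flipₗᵢ ℝ V V ℝ).contDiff.comp
    (((ContinuousLinearMap.flipₗᵢ ℝ V W ℝ).contDiff.comp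
      (contDiff_id.clm_comp contDiff_const)).clm_comp contDiff_const)

variable {μ G₁ G₂}

theorem contDiffOn_ambientForm {s : Set (((E₁ × E₂) × ℝ) × ℝ)} {s₁ : Set E₁} {s₂ : Set E₂}
    (h₁ : ContDiffOn ℝ ∞ G₁ s₁) (h₂ : ContDiffOn ℝ ∞ G₂ s₂)
    (hs₁ : MapsTo (fstProj E₁ E₂) s s₁) (hs₂ : MapsTo (sndProj E₁ E₂) s s₂) :
    ContDiffOn ℝ ∞ (ambientForm μ G₁ G₂) s := by
  have ht : ContDiffOn ℝ ∞ (fun y : ((E₁ × E₂) × ℝ) × ℝ => y.1.2) s :=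
    (tProj E₁ E₂).contDiff.contDiffOn
  have hρ : ContDiffOn ℝ ∞ (fun y : ((E₁ × E₂) × ℝ) × ℝ => y.2) s :=
    (rhoProj E₁ E₂).contDiff.contDiffOn
  have c₁ : ContDiffOn ℝ ∞ (fun y : ((E₁ × E₂) × ℝ) × ℝ =>
      (G₁ y.1.1.1).bilinearComp (fstProj E₁ E₂) (fstProj E₁ E₂)) s :=
    (contDiff_bilinearComp _).comp_contDiffOn (h₁.comp (fstProj E₁ E₂).contDiff.contDiffOn hs₁)
  have c₂ : ContDiffOn ℝ ∞ (fun y : ((E₁ × E₂) × ℝ) × ℝ =>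
      (G₂ y.1.1.2).bilinearComp (sndProj E₁ E₂) (sndProj E₁ E₂)) s :=
    (contDiff_bilinearComp _).comp_contDiffOn (h₂.comp (sndProj E₁ E₂).contDiff.contDiffOn hs₂)
  have a₁ : ContDiffOn ℝ ∞ (fun y : ((E₁ × E₂) × ℝ) × ℝ => y.1.2 ^ 2 * (1 + μ * y.2) ^ 2) s :=
    (ht.pow 2).mul ((contDiffOn_const.add (contDiffOn_const.mul hρ)).pow 2)
  have a₂ : ContDiffOn ℝ ∞ (fun y : ((E₁ × E₂) × ℝ) × ℝ => y.1.2 ^ 2 * (1 - μ * y.2) ^ 2) s :=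
    (ht.pow 2).mul ((contDiffOn_const.sub (contDiffOn_const.mul hρ)).pow 2)
  exact (((ht.smul contDiffOn_const).add ((contDiffOn_const.mul hρ).smul contDiffOn_const)).add
    (a₁.smul c₁)).add (a₂.smul c₂)

variable (μ G₁ G₂) in
/-- The points of a coordinate domain at which `ambientForm` is a metric. -/
structure IsRegularPoint (y : ((E₁ × E₂) × ℝ) × ℝ) : Prop where
  metric_fst : IsMetricNear G₁ y.1.1.1
  metric_snd : IsMetricNear G₂ y.1.1.2
  t_ne : y.1.2 ≠ 0
  fst_ne : 1 + μ * y.2 ≠ 0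
  snd_ne : 1 - μ * y.2 ≠ 0 ∨ Subsingleton E₂

theorem IsRegularPoint.eventually {y : ((E₁ × E₂) × ℝ) × ℝ} (h : IsRegularPoint μ G₁ G₂ y) :
    ∀ᶠ z in 𝓝 y, IsRegularPoint μ G₁ G₂ z := by
  have e₁ := (fstProj E₁ E₂).continuous.continuousAt.eventually
    (show ∀ᶠ z in 𝓝 (fstProj E₁ E₂ y), _ from h.metric_fst.eventually)
  have e₂ := (sndProj E₁ E₂).continuous.continuousAt.eventually
    (show ∀ᶠ z in 𝓝 (sndProj E₁ E₂ y), _ from h.metric_snd.eventually)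
  have ρc : Continuous (fun y : ((E₁ × E₂) × ℝ) × ℝ => y.2) := (rhoProj E₁ E₂).continuous
  have e₃ : ∀ᶠ z : ((E₁ × E₂) × ℝ) × ℝ in 𝓝 y, z.1.2 ≠ 0 :=
    (tProj E₁ E₂).continuous.continuousAt.eventually_ne h.t_ne
  have e₄ : ∀ᶠ z : ((E₁ × E₂) × ℝ) × ℝ in 𝓝 y, 1 + μ * z.2 ≠ 0 :=
    (continuous_const.add (continuous_const.mul ρc)).continuousAt.eventually_ne h.fst_ne
  have e₅ : ∀ᶠ z : ((E₁ × E₂) × ℝ) × ℝ in 𝓝 y, 1 - μ * z.2 ≠ 0 ∨ Subsingleton E₂ := by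
    rcases h.snd_ne with h' | h'
    · exact ((continuous_const.sub (continuous_const.mul ρc)).continuousAt.eventually_ne h').mono
        fun _ => Or.inl
    · exact Eventually.of_forall fun _ => Or.inr h'
  filter_upwards [e₁, e₂, e₃, e₄, e₅] with z h₁ h₂ h₃ h₄ h₅ using ⟨h₁, h₂, h₃, h₄, h₅⟩

theorem IsRegularPoint.isMetricNear {y : ((E₁ × E₂) × ℝ) × ℝ} (h : IsRegularPoint μ G₁ G₂ y) :
    IsMetricNear (ambientForm μ G₁ G₂) y where
  symm := by
    filter_upwards [h.eventually] with z hz v w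
    rw [ambientForm_apply, ambientForm_apply, hz.metric_fst.symm.self_of_nhds v.1.1.1,
      hz.metric_snd.symm.self_of_nhds v.1.1.2]
    ring
  nondegenerate := by
    filter_upwards [h.eventually] with z hz v hv
    have hρ : v.1.2 = 0 := by
      have := hv (((0, 0), 0), 1)
      rw [ambientForm_apply] at this
      simpa [hz.t_ne] using this
    have ht : v.2 = 0 := by
      have := hv (((0, 0), 1), 0)
      rw [ambientForm_apply] at this
      simpa [hz.t_ne, hρ] using this
    have h₁ : v.1.1.1 = 0 := by
      refine hz.metric_fst.nondegenerate.self_of_nhds _ fun w => ?_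
      have := hv (((w, 0), 0), 0)
      rw [ambientForm_apply] at this
      simpa [hz.t_ne, hz.fst_ne] using this
    have h₂ : v.1.1.2 = 0 := by
      rcases hz.snd_ne with h' | h'
      · refine hz.metric_snd.nondegenerate.self_of_nhds _ fun w => ?_
        have := hv (((0, w), 0), 0)
        rw [ambientForm_apply] at this
        simpa [hz.t_ne, h'] using this
      · exact Subsingleton.elim _ _
    exact Prod.ext (Prod.ext (Prod.ext h₁ h₂) hρ) ht
  smooth := by
    filter_upwards [h.eventually] with z hz
    obtain ⟨u₁, hu₁, h₁⟩ := hz.metric_fst.smooth.exists_mem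
    obtain ⟨u₂, hu₂, h₂⟩ := hz.metric_snd.smooth.exists_mem
    refine (contDiffOn_ambientForm (s := fstProj E₁ E₂ ⁻¹' u₁ ∩ sndProj E₁ E₂ ⁻¹' u₂)
      (fun x hx => (h₁ x hx).contDiffWithinAt) (fun x hx => (h₂ x hx).contDiffWithinAt)
      (fun x hx => hx.1) (fun x hx => hx.2)).contDiffAt ?_
    exact inter_mem ((fstProj E₁ E₂).continuous.continuousAt.preimage_mem_nhds hu₁)
      ((sndProj E₁ E₂).continuous.continuousAt.preimage_mem_nhds hu₂)

theorem hasDerivAt_line (a b : ℝ) : HasDerivAt (fun s : ℝ => a + s * b) b 0 := by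
  simpa using ((hasDerivAt_id (0 : ℝ)).mul_const b).const_add a

theorem IsRegularPoint.fderiv_ambientForm {y : ((E₁ × E₂) × ℝ) × ℝ}
    (h : IsRegularPoint μ G₁ G₂ y) (u v w : ((E₁ × E₂) × ℝ) × ℝ) :
    fderiv ℝ (ambientForm μ G₁ G₂) y u v w =
      u.1.2 * (v.1.2 * w.2 + v.2 * w.1.2) + 2 * u.2 * (v.1.2 * w.1.2)
      + (2 * y.1.2 * u.1.2 * (1 + μ * y.2) ^ 2 + y.1.2 ^ 2 * (2 * (1 + μ * y.2) * (μ * u.2))) *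
          G₁ y.1.1.1 v.1.1.1 w.1.1.1
      + y.1.2 ^ 2 * (1 + μ * y.2) ^ 2 * fderiv ℝ G₁ y.1.1.1 u.1.1.1 v.1.1.1 w.1.1.1
      + (2 * y.1.2 * u.1.2 * (1 - μ * y.2) ^ 2 - y.1.2 ^ 2 * (2 * (1 - μ * y.2) * (μ * u.2))) *
          G₂ y.1.1.2 v.1.1.2 w.1.1.2
      + y.1.2 ^ 2 * (1 - μ * y.2) ^ 2 * fderiv ℝ G₂ y.1.1.2 u.1.1.2 v.1.1.2 w.1.1.2 := by
  refine (hasDerivAt_bilin_line h.isMetricNear.differentiableAt u v w).unique ?_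
  have dt := hasDerivAt_line y.1.2 u.1.2
  have dρ := hasDerivAt_line y.2 u.2
  have d₁ := hasDerivAt_bilin_line h.metric_fst.differentiableAt u.1.1.1 v.1.1.1 w.1.1.1
  have d₂ := hasDerivAt_bilin_line h.metric_snd.differentiableAt u.1.1.2 v.1.1.2 w.1.1.2
  have e : (fun s : ℝ => ambientForm μ G₁ G₂ (y + s • u) v w) = fun s =>
      (y.1.2 + s * u.1.2) * (v.1.2 * w.2 + v.2 * w.1.2)
      + 2 * (y.2 + s * u.2) * (v.1.2 * w.1.2)
      + (y.1.2 + s * u.1.2) ^ 2 * (1 + μ * (y.2 + s * u.2)) ^ 2 *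
        G₁ (y.1.1.1 + s • u.1.1.1) v.1.1.1 w.1.1.1
      + (y.1.2 + s * u.1.2) ^ 2 * (1 - μ * (y.2 + s * u.2)) ^ 2 *
        G₂ (y.1.1.2 + s • u.1.1.2) v.1.1.2 w.1.1.2 := by
    funext s
    rw [ambientForm_apply]
    rfl
  rw [e]
  refine ((((dt.mul_const (v.1.2 * w.2 + v.2 * w.1.2)).add
    ((dρ.const_mul 2).mul_const (v.1.2 * w.1.2))).add
    (((dt.pow 2).mul (((dρ.const_mul μ).const_add 1).pow 2)).mul d₁)).add
    (((dt.pow 2).mul (((dρ.const_mul μ).const_sub 1).pow 2)).mul d₂)).congr_deriv ?_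
  simp only [Pi.mul_apply, Pi.pow_apply, zero_mul, zero_smul, add_zero, Nat.cast_ofNat]
  ring

variable [FiniteDimensional ℝ E₁] [FiniteDimensional ℝ E₂]

variable (μ G₁ G₂) in
/-- The Christoffel symbols of `ambientForm`. -/
def ambientChristoffel (y v w : ((E₁ × E₂) × ℝ) × ℝ) : ((E₁ × E₂) × ℝ) × ℝ :=
  (((christoffel G₁ y.1.1.1 v.1.1.1 w.1.1.1
        + (v.1.2 / y.1.2 + μ / (1 + μ * y.2) * v.2) • w.1.1.1
        + (w.1.2 / y.1.2 + μ / (1 + μ * y.2) * w.2) • v.1.1.1,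
      christoffel G₂ y.1.1.2 v.1.1.2 w.1.1.2
        + (v.1.2 / y.1.2 - μ / (1 - μ * y.2) * v.2) • w.1.1.2
        + (w.1.2 / y.1.2 - μ / (1 - μ * y.2) * w.2) • v.1.1.2),
    -(y.1.2 * μ * ((1 + μ * y.2) * G₁ y.1.1.1 v.1.1.1 w.1.1.1
      - (1 - μ * y.2) * G₂ y.1.1.2 v.1.1.2 w.1.1.2))),
  (v.1.2 * w.2 + v.2 * w.1.2) / y.1.2 - (1 + μ * y.2) * (1 - μ * y.2) *
    (G₁ y.1.1.1 v.1.1.1 w.1.1.1 + G₂ y.1.1.2 v.1.1.2 w.1.1.2))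

theorem IsRegularPoint.christoffel_eq {y : ((E₁ × E₂) × ℝ) × ℝ}
    (h : IsRegularPoint μ G₁ G₂ y) (v w : ((E₁ × E₂) × ℝ) × ℝ) :
    christoffel (ambientForm μ G₁ G₂) y v w = ambientChristoffel μ G₁ G₂ y v w := by
  rw [h.isMetricNear.christoffel_apply_eq_iff]
  intro z
  have k₁ : (1 + μ * y.2) ^ 2 *
      G₁ y.1.1.1 (ambientChristoffel μ G₁ G₂ y v w).1.1.1 z.1.1.1 =
      (1 + μ * y.2) ^ 2 * (1 / 2 * (fderiv ℝ G₁ y.1.1.1 v.1.1.1 w.1.1.1 z.1.1.1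
        + fderiv ℝ G₁ y.1.1.1 w.1.1.1 v.1.1.1 z.1.1.1
        - fderiv ℝ G₁ y.1.1.1 z.1.1.1 v.1.1.1 w.1.1.1))
      + ((1 + μ * y.2) ^ 2 * v.1.2 / y.1.2 + (1 + μ * y.2) * μ * v.2) *
        G₁ y.1.1.1 w.1.1.1 z.1.1.1
      + ((1 + μ * y.2) ^ 2 * w.1.2 / y.1.2 + (1 + μ * y.2) * μ * w.2) *
        G₁ y.1.1.1 v.1.1.1 z.1.1.1 := by
    have := h.fst_ne
    simp only [ambientChristoffel, map_add, map_smul, _root_.add_apply, _root_.smul_apply,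
      h.metric_fst.apply_christoffel, smul_eq_mul]
    field_simp
  have k₂ : (1 - μ * y.2) ^ 2 *
      G₂ y.1.1.2 (ambientChristoffel μ G₁ G₂ y v w).1.1.2 z.1.1.2 =
      (1 - μ * y.2) ^ 2 * (1 / 2 * (fderiv ℝ G₂ y.1.1.2 v.1.1.2 w.1.1.2 z.1.1.2
        + fderiv ℝ G₂ y.1.1.2 w.1.1.2 v.1.1.2 z.1.1.2
        - fderiv ℝ G₂ y.1.1.2 z.1.1.2 v.1.1.2 w.1.1.2))
      + ((1 - μ * y.2) ^ 2 * v.1.2 / y.1.2 - (1 - μ * y.2) * μ * v.2) *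
        G₂ y.1.1.2 w.1.1.2 z.1.1.2
      + ((1 - μ * y.2) ^ 2 * w.1.2 / y.1.2 - (1 - μ * y.2) * μ * w.2) *
        G₂ y.1.1.2 v.1.1.2 z.1.1.2 := by
    rcases h.snd_ne with h' | h'
    · simp only [ambientChristoffel, map_add, map_smul, _root_.add_apply, _root_.smul_apply,
        h.metric_snd.apply_christoffel, smul_eq_mul]
      field_simp
    · simp [Subsingleton.elim z.1.1.2 0, Subsingleton.elim v.1.1.2 0]
  rw [christoffelFirst_apply, h.fderiv_ambientForm, h.fderiv_ambientForm, h.fderiv_ambientForm,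
    ambientForm_apply,
    mul_assoc (y.1.2 ^ 2) _ (G₁ _ (ambientChristoffel μ G₁ G₂ y v w).1.1.1 _), k₁,
    mul_assoc (y.1.2 ^ 2) _ (G₂ _ (ambientChristoffel μ G₁ G₂ y v w).1.1.2 _), k₂]
  have := h.t_ne
  simp only [ambientChristoffel]
  field_simp
  ring

end AmbientForm

section AmbientRicci

variable {E₁ : Type*} [NormedAddCommGroup E₁] [NormedSpace ℝ E₁] [FiniteDimensional ℝ E₁]
  {E₂ : Type*} [NormedAddCommGroup E₂] [NormedSpace ℝ E₂] [FiniteDimensional ℝ E₂]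
  {μ : ℝ} {G₁ : E₁ → E₁ →L[ℝ] E₁ →L[ℝ] ℝ} {G₂ : E₂ → E₂ →L[ℝ] E₂ →L[ℝ] ℝ}
  {y : ((E₁ × E₂) × ℝ) × ℝ}

theorem IsRegularPoint.map_fderiv_christoffel (h : IsRegularPoint μ G₁ G₂ y)
    {F : Type*} [NormedAddCommGroup F] [NormedSpace ℝ F] (L : ((E₁ × E₂) × ℝ) × ℝ →L[ℝ] F)
    {u v w : ((E₁ × E₂) × ℝ) × ℝ} {d : F}
    (hd : HasDerivAt (fun s : ℝ => L (ambientChristoffel μ G₁ G₂ (y + s • u) v w)) d 0) :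
    L (fderiv ℝ (christoffel (ambientForm μ G₁ G₂)) y u v w) = d := by
  have h₁ := L.hasFDerivAt.comp_hasDerivAt (0 : ℝ)
    (hasDerivAt_bilin_line h.isMetricNear.differentiableAt_christoffel u v w)
  refine (h₁.congr_of_eventuallyEq ?_).unique hd
  have hc : Tendsto (fun s : ℝ => y + s • u) (𝓝 0) (𝓝 y) := by
    have : Continuous (fun s : ℝ => y + s • u) := by fun_prop
    simpa using this.tendsto 0
  filter_upwards [hc.eventually h.eventually] with s hs
  simp only [Function.comp_apply, hs.christoffel_eq]

theorem hasDerivAt_const_div_line {a : ℝ} (ha : a ≠ 0) (b c : ℝ) :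
    HasDerivAt (fun s : ℝ => c / (a + s * b)) (-(c * b) / a ^ 2) 0 := by
  have := (hasDerivAt_const (0 : ℝ) c).div (hasDerivAt_line a b) (by simpa using ha)
  exact this.congr_deriv (by simp)

theorem hasDerivAt_const_div_affine_line {ν ρ : ℝ} (ha : 1 + ν * ρ ≠ 0) (b c : ℝ) :
    HasDerivAt (fun s : ℝ => c / (1 + ν * (ρ + s * b))) (-(c * (ν * b)) / (1 + ν * ρ) ^ 2) 0 := by
  have := hasDerivAt_const_div_line ha (ν * b) c
  refine this.congr_of_eventuallyEq (Eventually.of_forall fun s => ?_)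
  ring_nf

theorem IsRegularPoint.fderiv_christoffel_fst (h : IsRegularPoint μ G₁ G₂ y)
    (u v w : ((E₁ × E₂) × ℝ) × ℝ) :
    (fderiv ℝ (christoffel (ambientForm μ G₁ G₂)) y u v w).1.1.1 =
      fderiv ℝ (christoffel G₁) y.1.1.1 u.1.1.1 v.1.1.1 w.1.1.1
      + (-(v.1.2 * u.1.2) / y.1.2 ^ 2 + -(μ * (μ * u.2)) / (1 + μ * y.2) ^ 2 * v.2) • w.1.1.1
      + (-(w.1.2 * u.1.2) / y.1.2 ^ 2 + -(μ * (μ * u.2)) / (1 + μ * y.2) ^ 2 * w.2) • v.1.1.1 := by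
  refine h.map_fderiv_christoffel (fstProj E₁ E₂) ?_
  have d₁ := hasDerivAt_bilin_line h.metric_fst.differentiableAt_christoffel
    u.1.1.1 v.1.1.1 w.1.1.1
  have dρ := hasDerivAt_const_div_affine_line h.fst_ne u.2 μ
  exact (d₁.add (((hasDerivAt_const_div_line h.t_ne u.1.2 v.1.2).add
    (dρ.mul_const v.2)).smul_const w.1.1.1)).add
    (((hasDerivAt_const_div_line h.t_ne u.1.2 w.1.2).add (dρ.mul_const w.2)).smul_const v.1.1.1)

theorem IsRegularPoint.fderiv_christoffel_snd (h : IsRegularPoint μ G₁ G₂ y)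
    (h₂ : 1 - μ * y.2 ≠ 0) (u v w : ((E₁ × E₂) × ℝ) × ℝ) :
    (fderiv ℝ (christoffel (ambientForm μ G₁ G₂)) y u v w).1.1.2 =
      fderiv ℝ (christoffel G₂) y.1.1.2 u.1.1.2 v.1.1.2 w.1.1.2
      + (-(v.1.2 * u.1.2) / y.1.2 ^ 2 + -(μ * (μ * u.2)) / (1 - μ * y.2) ^ 2 * v.2) • w.1.1.2
      + (-(w.1.2 * u.1.2) / y.1.2 ^ 2 + -(μ * (μ * u.2)) / (1 - μ * y.2) ^ 2 * w.2) •
        v.1.1.2 := by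
  refine h.map_fderiv_christoffel (sndProj E₁ E₂) ?_
  have e : ∀ r : ℝ, 1 - μ * r = 1 + -μ * r := fun r => by ring
  rw [e] at h₂
  have d₁ := hasDerivAt_bilin_line h.metric_snd.differentiableAt_christoffel
    u.1.1.2 v.1.1.2 w.1.1.2
  have dρ := hasDerivAt_const_div_affine_line h₂ u.2 μ
  simp only [ambientChristoffel, e]
  refine ((d₁.add (((hasDerivAt_const_div_line h.t_ne u.1.2 v.1.2).sub
    (dρ.mul_const v.2)).smul_const w.1.1.2)).add
    (((hasDerivAt_const_div_line h.t_ne u.1.2 w.1.2).sub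
      (dρ.mul_const w.2)).smul_const v.1.1.2)).congr_deriv ?_
  match_scalars <;> ring

theorem IsRegularPoint.curvatureEnd_fst (h : IsRegularPoint μ G₁ G₂ y)
    (v w : ((E₁ × E₂) × ℝ) × ℝ) (u : E₁) :
    (curvatureEnd (ambientForm μ G₁ G₂) y v w (((u, 0), 0), 0)).1.1.1 =
      curvatureEnd G₁ y.1.1.1 v.1.1.1 w.1.1.1 u
      + (-(2 * μ * G₁ y.1.1.1 v.1.1.1 w.1.1.1)) • u
      + (2 * μ * G₁ y.1.1.1 u w.1.1.1) • v.1.1.1 := by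
  have ht := h.t_ne
  have ha := h.fst_ne
  simp only [curvatureEnd_apply, h.christoffel_eq, Prod.fst_add, Prod.fst_sub,
    h.fderiv_christoffel_fst]
  simp only [ambientChristoffel, map_add, map_smul, map_zero,
    _root_.zero_apply]
  rw [h.metric_fst.christoffel_symm v.1.1.1 u]
  match_scalars <;> field_simp <;> ring

theorem IsRegularPoint.curvatureEnd_snd (h : IsRegularPoint μ G₁ G₂ y)
    (v w : ((E₁ × E₂) × ℝ) × ℝ) (u : E₂) :
    (curvatureEnd (ambientForm μ G₁ G₂) y v w (((0, u), 0), 0)).1.1.2 =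
      curvatureEnd G₂ y.1.1.2 v.1.1.2 w.1.1.2 u
      + (2 * μ * G₂ y.1.1.2 v.1.1.2 w.1.1.2) • u
      + (-(2 * μ * G₂ y.1.1.2 u w.1.1.2)) • v.1.1.2 := by
  rcases h.snd_ne with ha | ha
  swap
  · exact Subsingleton.elim _ _
  have ht := h.t_ne
  simp only [curvatureEnd_apply, h.christoffel_eq, Prod.fst_add, Prod.fst_sub, Prod.snd_add,
    Prod.snd_sub, h.fderiv_christoffel_snd ha]
  simp only [ambientChristoffel, map_add, map_smul, map_zero,
    _root_.zero_apply]
  rw [h.metric_snd.christoffel_symm v.1.1.2 u]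
  match_scalars <;> field_simp <;> ring

theorem IsRegularPoint.curvatureEnd_t (h : IsRegularPoint μ G₁ G₂ y)
    (v w : ((E₁ × E₂) × ℝ) × ℝ) :
    (curvatureEnd (ambientForm μ G₁ G₂) y v w (((0, 0), 1), 0)).1.2 = 0 := by
  have ht := h.t_ne
  have ha := h.fst_ne
  have d₁ : (fderiv ℝ (christoffel (ambientForm μ G₁ G₂)) y (((0, 0), 1), 0) v w).1.2 =
      -(μ * ((1 + μ * y.2) * G₁ y.1.1.1 v.1.1.1 w.1.1.1
        - (1 - μ * y.2) * G₂ y.1.1.2 v.1.1.2 w.1.1.2)) := by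
    refine h.map_fderiv_christoffel (tProj E₁ E₂) ?_
    have := (((hasDerivAt_line y.1.2 1).mul_const μ).mul_const
      ((1 + μ * y.2) * G₁ y.1.1.1 v.1.1.1 w.1.1.1
        - (1 - μ * y.2) * G₂ y.1.1.2 v.1.1.2 w.1.1.2)).neg
    refine (this.congr_deriv (by ring)).congr_of_eventuallyEq (Eventually.of_forall fun s => ?_)
    simp [ambientChristoffel]
  have d₂ : (fderiv ℝ (christoffel (ambientForm μ G₁ G₂)) y v (((0, 0), 1), 0) w).1.2 = 0 := by
    refine h.map_fderiv_christoffel (tProj E₁ E₂) ?_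
    refine (hasDerivAt_const (0 : ℝ) (0 : ℝ)).congr_of_eventuallyEq
      (Eventually.of_forall fun s => ?_)
    simp [ambientChristoffel]
  simp only [curvatureEnd_apply, h.christoffel_eq, Prod.fst_add, Prod.fst_sub, Prod.snd_add,
    Prod.snd_sub, d₁, d₂]
  simp only [ambientChristoffel, map_add, map_smul, map_zero,
    _root_.zero_apply, smul_eq_mul]
  field_simp
  ring

theorem IsRegularPoint.curvatureEnd_rho (h : IsRegularPoint μ G₁ G₂ y)
    (v w : ((E₁ × E₂) × ℝ) × ℝ) :
    (curvatureEnd (ambientForm μ G₁ G₂) y v w (((0, 0), 0), 1)).2 = 0 := by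
  have ht := h.t_ne
  have ha := h.fst_ne
  have d₁ : (fderiv ℝ (christoffel (ambientForm μ G₁ G₂)) y (((0, 0), 0), 1) v w).2 =
      2 * μ ^ 2 * y.2 * (G₁ y.1.1.1 v.1.1.1 w.1.1.1 + G₂ y.1.1.2 v.1.1.2 w.1.1.2) := by
    refine h.map_fderiv_christoffel (rhoProj E₁ E₂) ?_
    have dρ := (hasDerivAt_line y.2 1).const_mul μ
    have := (((dρ.const_add 1).mul (dρ.const_sub 1)).mul_const
      (G₁ y.1.1.1 v.1.1.1 w.1.1.1 + G₂ y.1.1.2 v.1.1.2 w.1.1.2)).const_sub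
        ((v.1.2 * w.2 + v.2 * w.1.2) / y.1.2)
    refine (this.congr_deriv (by ring)).congr_of_eventuallyEq (Eventually.of_forall fun s => ?_)
    simp [ambientChristoffel]
  have d₂ : (fderiv ℝ (christoffel (ambientForm μ G₁ G₂)) y v (((0, 0), 0), 1) w).2 =
      -(w.1.2 * v.1.2) / y.1.2 ^ 2 := by
    refine h.map_fderiv_christoffel (rhoProj E₁ E₂) ?_
    refine (hasDerivAt_const_div_line ht v.1.2 w.1.2).congr_of_eventuallyEq
      (Eventually.of_forall fun s => ?_)
    simp [ambientChristoffel]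
  have k₂ : ∀ x x' : E₂, (1 - μ * y.2) * (μ / (1 - μ * y.2) * G₂ y.1.1.2 x x') =
      μ * G₂ y.1.1.2 x x' := by
    intro x x'
    rcases h.snd_ne with h' | h'
    · field_simp
    · simp [Subsingleton.elim x 0]
  have k₂' := k₂ v.1.1.2 w.1.1.2
  simp only [curvatureEnd_apply, h.christoffel_eq, Prod.snd_add,
    Prod.snd_sub, d₁, d₂]
  simp only [ambientChristoffel, map_add, map_smul, map_zero,
    _root_.zero_apply, smul_eq_mul]
  generalize μ / (1 - μ * y.2) = b at *
  field_simp
  linear_combination (-(1 + μ * y.2) * y.1.2 ^ 2) * k₂'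

/-- The metric `ambientForm` is Ricci-flat if `Ric(G₁) = 2 (m₁ - 1) μ G₁` and
`Ric(G₂) = - 2 (m₂ - 1) μ G₂` at the base points, where `mₖ = dim Eₖ`. -/
theorem IsRegularPoint.ricciLocal_eq_zero (h : IsRegularPoint μ G₁ G₂ y)
    (hR₁ : ∀ v w, ricciLocal G₁ y.1.1.1 v w =
      2 * (Module.finrank ℝ E₁ - 1) * μ * G₁ y.1.1.1 v w)
    (hR₂ : ∀ v w, ricciLocal G₂ y.1.1.2 v w =
      -(2 * (Module.finrank ℝ E₂ - 1) * μ * G₂ y.1.1.2 v w)) :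
    ricciLocal (ambientForm μ G₁ G₂) y = 0 := by
  refine LinearMap.ext fun v => LinearMap.ext fun w => ?_
  change LinearMap.trace ℝ _ (curvatureEnd (ambientForm μ G₁ G₂) y v w) = 0
  rw [trace_prod, trace_prod, trace_prod, trace_real, trace_real]
  have t₁ : LinearMap.fst ℝ E₁ E₂ ∘ₗ (LinearMap.fst ℝ (E₁ × E₂) ℝ ∘ₗ
      (LinearMap.fst ℝ ((E₁ × E₂) × ℝ) ℝ ∘ₗ
        curvatureEnd (ambientForm μ G₁ G₂) y v w ∘ₗ LinearMap.inl ℝ ((E₁ × E₂) × ℝ) ℝ) ∘ₗ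
      LinearMap.inl ℝ (E₁ × E₂) ℝ) ∘ₗ LinearMap.inl ℝ E₁ E₂ =
      curvatureEnd G₁ y.1.1.1 v.1.1.1 w.1.1.1
      + (-(2 * μ * G₁ y.1.1.1 v.1.1.1 w.1.1.1)) • LinearMap.id
      + (2 * μ) • ((G₁ y.1.1.1).flip w.1.1.1).toLinearMap.smulRight v.1.1.1 := by
    ext u
    refine (h.curvatureEnd_fst v w u).trans ?_
    simp [mul_smul]
  have t₂ : LinearMap.snd ℝ E₁ E₂ ∘ₗ (LinearMap.fst ℝ (E₁ × E₂) ℝ ∘ₗ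
      (LinearMap.fst ℝ ((E₁ × E₂) × ℝ) ℝ ∘ₗ
        curvatureEnd (ambientForm μ G₁ G₂) y v w ∘ₗ LinearMap.inl ℝ ((E₁ × E₂) × ℝ) ℝ) ∘ₗ
      LinearMap.inl ℝ (E₁ × E₂) ℝ) ∘ₗ LinearMap.inr ℝ E₁ E₂ =
      curvatureEnd G₂ y.1.1.2 v.1.1.2 w.1.1.2
      + (2 * μ * G₂ y.1.1.2 v.1.1.2 w.1.1.2) • LinearMap.id
      + (-(2 * μ)) • ((G₂ y.1.1.2).flip w.1.1.2).toLinearMap.smulRight v.1.1.2 := by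
    ext u
    refine (h.curvatureEnd_snd v w u).trans ?_
    simp [mul_smul]
  have t₃ := h.curvatureEnd_t v w
  have t₄ := h.curvatureEnd_rho v w
  have r₁ : LinearMap.trace ℝ E₁ (curvatureEnd G₁ y.1.1.1 v.1.1.1 w.1.1.1) = _ :=
    hR₁ v.1.1.1 w.1.1.1
  have r₂ : LinearMap.trace ℝ E₂ (curvatureEnd G₂ y.1.1.2 v.1.1.2 w.1.1.2) = _ :=
    hR₂ v.1.1.2 w.1.1.2
  rw [t₁, t₂]
  simp only [map_add, map_smul, r₁, r₂, LinearMap.trace_id, trace_rank_one, smul_eq_mul,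
    LinearMap.comp_apply, LinearMap.inl_apply, LinearMap.inr_apply, LinearMap.fst_apply,
    LinearMap.snd_apply, ContinuousLinearMap.coe_coe, ContinuousLinearMap.flip_apply]
  erw [t₃, t₄]
  ring

end AmbientRicci

/-! ### Signature -/

section Signature

variable {V W : Type*} [AddCommGroup V] [Module ℝ V] [FiniteDimensional ℝ V]
  [AddCommGroup W] [Module ℝ W]

theorem finrank_le_sigPos_of_comp (Q : QuadraticForm ℝ V) (f : W →ₗ[ℝ] V)
    (hf : ∀ x, x ≠ 0 → 0 < Q (f x)) : Module.finrank ℝ W ≤ sigPos Q := by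
  have hinj : Function.Injective f := by
    rw [← LinearMap.ker_eq_bot, LinearMap.ker_eq_bot']
    intro x hx
    by_contra hne
    simpa [hx] using hf x hne
  rw [← LinearMap.finrank_range_of_inj hinj]
  refine le_sigPos_of_posDef Q ?_
  rintro ⟨_, x, rfl⟩ hx
  exact hf x fun h => hx (by simp [h])

theorem sigPos_add_sigNeg_of_nondegenerate (B : LinearMap.BilinForm ℝ V)
    (hs : ∀ v w, B v w = B w v) (hB : ∀ v, (∀ w, B v w = 0) → v = 0) :
    sigPos B.toQuadraticMap + sigNeg B.toQuadraticMap = Module.finrank ℝ V := by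
  have hr : B.toQuadraticMap.radical = ⊥ := by
    rw [QuadraticMap.radical_eq_ker_polarBilin, LinearMap.ker_eq_bot']
    intro v hv
    refine hB v fun w => ?_
    have := congrArg (fun L : V →ₗ[ℝ] ℝ => L w) hv
    simp only [QuadraticMap.polarBilin_apply_apply, LinearMap.BilinMap.polar_toQuadraticMap,
      LinearMap.zero_apply, hs w v] at this
    linarith
  have := QuadraticForm.sigPos_add_sigNeg_add_radical (Q := B.toQuadraticMap)
  rw [hr, finrank_bot, add_zero] at this
  exact this

variable {V₁ V₂ : Type*} [AddCommGroup V₁] [Module ℝ V₁] [FiniteDimensional ℝ V₁]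
  [AddCommGroup V₂] [Module ℝ V₂] [FiniteDimensional ℝ V₂]

theorem sigPos_add_sigPos_add_one_le (Q₁ : QuadraticForm ℝ V₁) (Q₂ : QuadraticForm ℝ V₂)
    (Q : QuadraticForm ℝ (((V₁ × V₂) × ℝ) × ℝ)) {t ρ a₁ a₂ : ℝ} (ht : t ≠ 0) (h₁ : 0 < a₁)
    (h₂ : 0 < a₂ ∨ Subsingleton V₂)
    (hQ : ∀ v, Q v = 2 * t * (v.1.2 * v.2) + 2 * ρ * (v.1.2 * v.1.2)
      + a₁ * Q₁ v.1.1.1 + a₂ * Q₂ v.1.1.2) :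
    sigPos Q₁ + sigPos Q₂ + 1 ≤ sigPos Q := by
  obtain ⟨U₁, hd₁, hU₁⟩ := exists_finrank_eq_sigPos_and_posDef Q₁
  obtain ⟨U₂, hd₂, hU₂⟩ := exists_finrank_eq_sigPos_and_posDef Q₂
  have hd : Module.finrank ℝ ((U₁ × U₂) × ℝ) = sigPos Q₁ + sigPos Q₂ + 1 := by
    rw [Module.finrank_prod, Module.finrank_prod, hd₁, hd₂, Module.finrank_self]
  rw [← hd]
  refine finrank_le_sigPos_of_comp Q
    (((U₁.subtype.prodMap U₂.subtype).prodMap LinearMap.id).prod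
      (((1 - ρ) / t) • LinearMap.snd ℝ (U₁ × U₂) ℝ)) ?_
  rintro ⟨⟨x₁, x₂⟩, s⟩ hx
  rw [hQ]
  change 0 < 2 * t * (s * ((1 - ρ) / t * s)) + 2 * ρ * (s * s) + a₁ * Q₁ x₁ + a₂ * Q₂ x₂
  have e : 2 * t * (s * ((1 - ρ) / t * s)) + 2 * ρ * (s * s) = 2 * s ^ 2 := by
    field_simp; ring
  rw [e]
  have n₁ : 0 ≤ a₁ * Q₁ x₁ := mul_nonneg h₁.le (hU₁.nonneg x₁)
  have n₂ : 0 ≤ a₂ * Q₂ x₂ := by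
    rcases h₂ with h | h
    · exact mul_nonneg h.le (hU₂.nonneg x₂)
    · simp [Subsingleton.elim (x₂ : V₂) 0]
  by_cases hs : s = 0
  · by_cases hx₁ : x₁ = 0
    · have hx₂ : x₂ ≠ 0 := by
        rintro rfl
        exact hx (by simp [hs, hx₁])
      rcases h₂ with h | h
      · have : 0 < a₂ * Q₂ x₂ := mul_pos h (hU₂ x₂ hx₂)
        positivity
      · exact absurd (Subsingleton.elim _ _) hx₂
    · have : 0 < a₁ * Q₁ x₁ := mul_pos h₁ (hU₁ x₁ hx₁)
      positivity
  · positivity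

/-- The signature of `2 t dt dρ + 2 ρ dt² + a₁ B₁ + a₂ B₂`. -/
theorem sigPos_sigNeg_of_sum (B₁ : LinearMap.BilinForm ℝ V₁) (B₂ : LinearMap.BilinForm ℝ V₂)
    (B : LinearMap.BilinForm ℝ (((V₁ × V₂) × ℝ) × ℝ))
    (hs₁ : ∀ v w, B₁ v w = B₁ w v) (hB₁ : ∀ v, (∀ w, B₁ v w = 0) → v = 0)
    (hs₂ : ∀ v w, B₂ v w = B₂ w v) (hB₂ : ∀ v, (∀ w, B₂ v w = 0) → v = 0)
    {t ρ a₁ a₂ : ℝ} (ht : t ≠ 0) (h₁ : 0 < a₁) (h₂ : 0 < a₂ ∨ Subsingleton V₂)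
    (hB : ∀ v, B v v = 2 * t * (v.1.2 * v.2) + 2 * ρ * (v.1.2 * v.1.2)
      + a₁ * B₁ v.1.1.1 v.1.1.1 + a₂ * B₂ v.1.1.2 v.1.1.2) :
    sigPos B.toQuadraticMap = sigPos B₁.toQuadraticMap + sigPos B₂.toQuadraticMap + 1 ∧
      sigNeg B.toQuadraticMap = sigNeg B₁.toQuadraticMap + sigNeg B₂.toQuadraticMap + 1 := by
  have hp := sigPos_add_sigPos_add_one_le B₁.toQuadraticMap B₂.toQuadraticMap B.toQuadraticMap
    ht h₁ h₂ hB
  have hn : sigNeg B₁.toQuadraticMap + sigNeg B₂.toQuadraticMap + 1 ≤ sigNeg B.toQuadraticMap := by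
    refine sigPos_add_sigPos_add_one_le (-B₁.toQuadraticMap) (-B₂.toQuadraticMap)
      (-B.toQuadraticMap) (t := -t) (ρ := -ρ) (neg_ne_zero.2 ht) h₁ h₂ fun v => ?_
    simp only [neg_apply, LinearMap.BilinMap.toQuadraticMap_apply, hB]
    ring
  have hd₁ := sigPos_add_sigNeg_of_nondegenerate B₁ hs₁ hB₁
  have hd₂ := sigPos_add_sigNeg_of_nondegenerate B₂ hs₂ hB₂
  have htot := QuadraticForm.sigPos_add_sigNeg_add_radical (Q := B.toQuadraticMap)
  rw [Module.finrank_prod, Module.finrank_prod, Module.finrank_prod, Module.finrank_self] at htot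
  omega

end Signature

/-! ### Metrics in charts -/

section Charts

variable {E : Type*} [NormedAddCommGroup E] [NormedSpace ℝ E]
  {H : Type*} [TopologicalSpace H] {I : ModelWithCorners ℝ E H} [I.Boundaryless]
  {M : Type*} [TopologicalSpace M] [ChartedSpace H M] [IsManifold I ∞ M]

theorem contMDiffAt_extChartAt_symm (x : M) {y : E} (hy : y ∈ (extChartAt I x).target) :
    ContMDiffAt 𝓘(ℝ, E) I ∞ (extChartAt I x).symm y :=
  (contMDiffOn_extChartAt_symm (n := ∞) x).contMDiffAt ((isOpen_extChartAt_target x).mem_nhds hy)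

theorem mdifferentiableAt_extChartAt_symm (x : M) {y : E} (hy : y ∈ (extChartAt I x).target) :
    MDifferentiableAt 𝓘(ℝ, E) I (extChartAt I x).symm y :=
  (contMDiffAt_extChartAt_symm x hy).mdifferentiableAt (by simp)

theorem isInvertible_mfderiv_extChartAt_symm (x : M) {y : E} (hy : y ∈ (extChartAt I x).target) :
    (mfderiv 𝓘(ℝ, E) I (extChartAt I x).symm y).IsInvertible := by
  have : IsManifold I 1 M := IsManifold.of_le (n := ∞) (by norm_cast)
  have := isInvertible_mfderivWithin_extChartAt_symm (I := I) hy
  rwa [I.range_eq_univ, mfderivWithin_univ] at this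

theorem mfderiv_extChartAt_symm_self (x : M) :
    mfderiv 𝓘(ℝ, E) I (extChartAt I x).symm (extChartAt I x x) = ContinuousLinearMap.id ℝ E := by
  have : IsManifold I 1 M := IsManifold.of_le (n := ∞) (by norm_cast)
  have := mfderivWithin_range_extChartAt_symm (I := I) (x := x)
  rwa [I.range_eq_univ, mfderivWithin_univ] at this

variable [FiniteDimensional ℝ E]

omit [I.Boundaryless] [IsManifold I ∞ M] in
theorem inChart_apply (g : BilinField I M) (x : M) (y v w : E) :
    inChart g x y v w = g ((extChartAt I x).symm y)
      (mfderiv 𝓘(ℝ, E) I (extChartAt I x).symm y v)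
      (mfderiv 𝓘(ℝ, E) I (extChartAt I x).symm y w) := rfl

theorem inChart_self (g : BilinField I M) (x : M) (v w : E) :
    inChart g x (extChartAt I x x) v w = g x v w := by
  refine (congrArg (fun L : E →L[ℝ] E => g ((extChartAt I x).symm (extChartAt I x x)) (L v) (L w))
    (mfderiv_extChartAt_symm_self (I := I) x)).trans ?_
  exact congrArg (fun z : M => (g z : LinearMap.BilinForm ℝ E) v w) (extChartAt_to_inv x)

theorem IsPseudoMetric.isMetricNear {g : BilinField I M} (hg : IsPseudoMetric g) (x : M) {y : E}
    (hy : y ∈ (extChartAt I x).target) : IsMetricNear (inChart g x) y where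
  symm := Eventually.of_forall fun z v w => hg.symm _ _ _
  nondegenerate := by
    filter_upwards [(isOpen_extChartAt_target x).mem_nhds hy] with z hz v hv
    obtain ⟨e, he⟩ := isInvertible_mfderiv_extChartAt_symm (I := I) x hz
    have h₀ : mfderiv 𝓘(ℝ, E) I (extChartAt I x).symm z v = 0 := by
      refine hg.nondegenerate _ _ fun w => ?_
      have hw : mfderiv 𝓘(ℝ, E) I (extChartAt I x).symm z (e.symm w) = w := by
        rw [← he]
        exact e.apply_symm_apply w
      have := (inChart_apply g x z v (e.symm w)).symm.trans (hv _)
      rwa [hw] at this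
    rw [← he] at h₀
    exact e.injective (h₀.trans (map_zero e).symm)
  smooth := by
    filter_upwards [(isOpen_extChartAt_target x).mem_nhds hy] with z hz
    exact (hg.smooth x).contDiffAt ((isOpen_extChartAt_target x).mem_nhds hz)

/-- The Ricci tensor of an Einstein metric, with the constant expressed by the scalar curvature. -/
theorem IsEinstein.finrank_mul_ricci {g : BilinField I M} (hg : IsPseudoMetric g)
    (hE : IsEinstein g) (x : M) (v w : E) :
    Module.finrank ℝ E * ricciLocal (inChart g x) (extChartAt I x x) v w =
      scalarCurvature g x * inChart g x (extChartAt I x x) v w := by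
  obtain ⟨c, hc⟩ := hE
  have hR : ricciLocal (inChart g x) (extChartAt I x x) = c • (g x : LinearMap.BilinForm ℝ E) :=
    hc x
  have hG := (hg.isMetricNear x (mem_extChartAt_target (I := I) x)).isInvertible
  have hS : scalarCurvature g x = c * Module.finrank ℝ E := by
    unfold scalarCurvature scalarLocal
    have : (inChart g x (extChartAt I x x)).inverse.toLinearMap ∘ₗ
        (LinearMap.toContinuousLinearMap : (E →ₗ[ℝ] ℝ) ≃ₗ[ℝ] (E →L[ℝ] ℝ)).toLinearMap ∘ₗ
        ricciLocal (inChart g x) (extChartAt I x x) = c • LinearMap.id := by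
      refine LinearMap.ext fun v => ?_
      change (inChart g x (extChartAt I x x)).inverse
        (LinearMap.toContinuousLinearMap (ricciLocal (inChart g x) (extChartAt I x x) v)) = c • v
      rw [hG.inverse_apply_eq]
      ext w
      rw [map_smul, hR]
      exact congrArg (c * ·) (inChart_self g x v w).symm
    rw [this, map_smul, LinearMap.trace_id, smul_eq_mul]
  rw [hS, hR, inChart_self]
  change _ * (c * _) = _
  ring

end Charts

/-! ### The smooth structure of the ray bundle -/

section Opens

theorem Opens.extChartAt_target (U : Opens ℝ) (s : U) :
    (extChartAt 𝓘(ℝ, ℝ) s).target = U := by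
  simp [extChartAt, chartAt, ChartedSpace.chartAt, OpenPartialHomeomorph.subtypeRestr]

theorem contMDiff_posReal_val : ContMDiff 𝓘(ℝ, ℝ) 𝓘(ℝ, ℝ) ∞ (fun s : PosReal => (s : ℝ)) :=
  contMDiff_subtype_val (U := (⟨Ioi 0, isOpen_Ioi⟩ : Opens ℝ))

theorem PosReal.extChartAt_target (s : PosReal) :
    (extChartAt 𝓘(ℝ, ℝ) s).target = Ioi (0 : ℝ) :=
  Opens.extChartAt_target (⟨Ioi 0, isOpen_Ioi⟩ : Opens ℝ) s

end Opens

section RayBundle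

variable {E : Type*} [NormedAddCommGroup E] [NormedSpace ℝ E] [FiniteDimensional ℝ E]
  [Nontrivial E] {H : Type*} [TopologicalSpace H] {I : ModelWithCorners ℝ E H}
  {M : Type*} [TopologicalSpace M] [ChartedSpace H M] [IsManifold I ∞ M]
  (g : PseudoMetric I M)

open RayBundle
theorem contMDiff_homeo : ContMDiff (I.prod 𝓘(ℝ, ℝ)) (I.prod 𝓘(ℝ, ℝ)) ∞ (homeo g) := by
  intro u
  have h₁ := (contMDiffOn_chart (I := I.prod 𝓘(ℝ, ℝ)) (n := ∞) (x := u)).contMDiffAt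
    ((chartAt _ u).open_source.mem_nhds (mem_chart_source _ u))
  have h₂ := (contMDiffOn_chart_symm (I := I.prod 𝓘(ℝ, ℝ)) (n := ∞) (x := homeo g u)).contMDiffAt
    ((chartAt _ (homeo g u)).open_target.mem_nhds (mem_chart_target _ (homeo g u)))
  refine (ContMDiffAt.comp u (g := (chartAt (ModelProd H ℝ) (homeo g u)).symm) h₂
    h₁).congr_of_eventuallyEq ?_
  filter_upwards [(chartAt (ModelProd H ℝ) u).open_source.mem_nhds (mem_chart_source _ u)] with z hz
  exact ((chartAt (ModelProd H ℝ) (homeo g u)).left_inv hz.2).symm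

theorem contMDiff_homeo_symm : ContMDiff (I.prod 𝓘(ℝ, ℝ)) (I.prod 𝓘(ℝ, ℝ)) ∞ (homeo g).symm := by
  intro z
  obtain ⟨u, rfl⟩ := (homeo g).surjective z
  have h₁ := (contMDiffOn_chart (I := I.prod 𝓘(ℝ, ℝ)) (n := ∞) (x := homeo g u)).contMDiffAt
    ((chartAt _ (homeo g u)).open_source.mem_nhds (mem_chart_source _ (homeo g u)))
  have h₂ := (contMDiffOn_chart_symm (I := I.prod 𝓘(ℝ, ℝ)) (n := ∞) (x := u)).contMDiffAt
    ((chartAt _ u).open_target.mem_nhds (mem_chart_target _ u))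
  refine (ContMDiffAt.comp (homeo g u) (g := (chartAt (ModelProd H ℝ) u).symm) h₂
    h₁).congr_of_eventuallyEq ?_
  filter_upwards [(chartAt (ModelProd H ℝ) (homeo g u)).open_source.mem_nhds
    (mem_chart_source _ (homeo g u))] with z hz
  exact (congrArg (homeo g).symm ((chartAt (ModelProd H ℝ) (homeo g u)).left_inv hz)).symm

end RayBundle

section RayBundleCoordinates

variable {E : Type*} [NormedAddCommGroup E] [NormedSpace ℝ E] [FiniteDimensional ℝ E]
  [Nontrivial E] {H : Type*} [TopologicalSpace H] {I : ModelWithCorners ℝ E H}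
  {M : Type*} [TopologicalSpace M] [ChartedSpace H M]
  {g : PseudoMetric I M}

namespace RayBundle

theorem extChartAt_target (u : RayBundle g) :
    (extChartAt (I.prod 𝓘(ℝ, ℝ)) u).target = (extChartAt I u.base).target ×ˢ Ioi (0 : ℝ) := by
  have h : (extChartAt (I.prod 𝓘(ℝ, ℝ)) u).target =
      (extChartAt (I.prod 𝓘(ℝ, ℝ)) (homeo g u)).target := by
    simp [extChartAt, chartAt, ChartedSpace.chartAt]
  rw [h, extChartAt_prod, ← PosReal.extChartAt_target u.scale]
  rfl

theorem base_extChartAt_symm (u : RayBundle g) (y : E × ℝ) :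
    ((extChartAt (I.prod 𝓘(ℝ, ℝ)) u).symm y).base = (extChartAt I u.base).symm y.1 :=
  congrArg Prod.fst ((homeo g).apply_symm_apply
    ((extChartAt (I.prod 𝓘(ℝ, ℝ)) (homeo g u)).symm y))

theorem scale_extChartAt_symm (u : RayBundle g) {y : E × ℝ} (hy : 0 < y.2) :
    (((extChartAt (I.prod 𝓘(ℝ, ℝ)) u).symm y).scale : ℝ) = y.2 := by
  have h := congrArg Prod.snd ((homeo g).apply_symm_apply
    ((extChartAt (I.prod 𝓘(ℝ, ℝ)) (homeo g u)).symm y))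
  have hy' : y.2 ∈ (extChartAt 𝓘(ℝ, ℝ) u.scale).target := by
    rw [PosReal.extChartAt_target]; exact hy
  exact (congrArg Subtype.val h).trans ((extChartAt 𝓘(ℝ, ℝ) u.scale).right_inv hy')

theorem scale_dilate (s : PosReal) (u : RayBundle g) : (u.dilate s).scale = s * u.scale :=
  scale_eq _ _ (by
    change (s : ℝ) ^ 2 • u.form = ((s : ℝ) * (u.scale : ℝ)) ^ 2 • g.val u.base
    rw [u.form_eq, smul_smul, ← mul_pow])

theorem ext_base_scale {u u' : RayBundle g} (hb : u.base = u'.base) (hs : u.scale = u'.scale) :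
    u = u' :=
  (homeo g).injective (Prod.ext hb hs)

variable [IsManifold I ∞ M]

theorem contMDiff_base : ContMDiff (I.prod 𝓘(ℝ, ℝ)) I ∞ (base : RayBundle g → M) :=
  contMDiff_fst.comp (contMDiff_homeo g)

theorem contMDiff_scale : ContMDiff (I.prod 𝓘(ℝ, ℝ)) 𝓘(ℝ, ℝ) ∞ (scale : RayBundle g → PosReal) :=
  contMDiff_snd.comp (contMDiff_homeo g)

theorem contMDiff_scale_val :
    ContMDiff (I.prod 𝓘(ℝ, ℝ)) 𝓘(ℝ, ℝ) ∞ (fun u : RayBundle g => (u.scale : ℝ)) :=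
  contMDiff_posReal_val.comp contMDiff_scale

theorem _root_.AmbientGeometry.contMDiff_posReal_mul :
    ContMDiff (𝓘(ℝ, ℝ).prod 𝓘(ℝ, ℝ)) 𝓘(ℝ, ℝ) ∞ (fun z : PosReal × PosReal => z.1 * z.2) := by
  intro z
  have hi : Manifold.IsImmersionAt 𝓘(ℝ, ℝ) 𝓘(ℝ, ℝ) ∞ (fun s : PosReal => (s : ℝ)) (z.1 * z.2) :=
    Manifold.IsImmersionAt.of_opens (⟨Ioi 0, isOpen_Ioi⟩ : Opens ℝ) (z.1 * z.2).2
  refine (ContMDiffAt.iff_comp_isImmersionAt (f := fun z : PosReal × PosReal => z.1 * z.2) hi).2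
    ⟨?_, ?_⟩
  · exact (((continuous_subtype_val.comp continuous_fst).mul
      (continuous_subtype_val.comp continuous_snd)).subtype_mk _).continuousAt
  have h₁ : ContMDiff (𝓘(ℝ, ℝ).prod 𝓘(ℝ, ℝ)) 𝓘(ℝ, ℝ) ∞ (fun z : PosReal × PosReal => (z.1 : ℝ)) :=
    contMDiff_posReal_val.comp contMDiff_fst
  have h₂ : ContMDiff (𝓘(ℝ, ℝ).prod 𝓘(ℝ, ℝ)) 𝓘(ℝ, ℝ) ∞ (fun z : PosReal × PosReal => (z.2 : ℝ)) :=
    contMDiff_posReal_val.comp contMDiff_snd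
  exact (h₁.mul h₂) z

theorem contMDiff_dilate :
    ContMDiff (𝓘(ℝ, ℝ).prod (I.prod 𝓘(ℝ, ℝ))) (I.prod 𝓘(ℝ, ℝ)) ∞
      (fun z : PosReal × RayBundle g => z.2.dilate z.1) := by
  have h : ContMDiff (𝓘(ℝ, ℝ).prod (I.prod 𝓘(ℝ, ℝ))) (I.prod 𝓘(ℝ, ℝ)) ∞
      (fun z : PosReal × RayBundle g => ((z.2.base, z.1 * z.2.scale) : M × PosReal)) :=
    (contMDiff_base.comp contMDiff_snd).prodMk
      (contMDiff_posReal_mul.comp (contMDiff_fst.prodMk (contMDiff_scale.comp contMDiff_snd)))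
  have e : (fun z : PosReal × RayBundle g => z.2.dilate z.1) =
      fun z => (homeo g).symm (z.2.base, z.1 * z.2.scale) := by
    funext z
    rw [Homeomorph.eq_symm_apply]
    exact Prod.ext rfl (scale_dilate z.1 z.2)
  rw [e]
  exact (contMDiff_homeo_symm g).comp h

end RayBundle

end RayBundleCoordinates

section Immersion

variable {E : Type*} [NormedAddCommGroup E] [NormedSpace ℝ E]
  {H : Type*} [TopologicalSpace H] {I : ModelWithCorners ℝ E H}
  {M : Type*} [TopologicalSpace M] [ChartedSpace H M] [IsManifold I ∞ M]
  {E' : Type*} [NormedAddCommGroup E'] [NormedSpace ℝ E']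
  {H' : Type*} [TopologicalSpace H'] {I' : ModelWithCorners ℝ E' H'}
  {M' : Type*} [TopologicalSpace M'] [ChartedSpace H' M'] [IsManifold I' ∞ M']

/-- The inclusion of a slice `M × {c}` in a product of manifolds is an embedding, if the
preferred chart at `c` is centred. -/
theorem isSmoothEmbedding_prodMk_const (c : M') (hc : extChartAt I' c c = 0) :
    Manifold.IsSmoothEmbedding I (I.prod I') ∞ (fun x : M => (x, c)) := by
  refine ⟨Manifold.IsImmersionOfComplement.isImmersion (F := E') fun x => ?_,
    isEmbedding_prodMkLeft c⟩
  refine .mk_of_continuousAt (by fun_prop) (.refl ℝ (E × E')) (chartAt H x)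
    (chartAt (ModelProd H H') (x, c)) (mem_chart_source H x) (mem_chart_source _ (x, c))
    (IsManifold.chart_mem_maximalAtlas x) (IsManifold.chart_mem_maximalAtlas (x, c)) ?_
  intro y hy
  exact Prod.ext ((extChartAt I x).right_inv hy) hc

end Immersion

theorem mfderiv_mfderiv_extChartAt_symm
    {E : Type*} [NormedAddCommGroup E] [NormedSpace ℝ E]
    {H : Type*} [TopologicalSpace H] {I : ModelWithCorners ℝ E H} [I.Boundaryless]
    {M : Type*} [TopologicalSpace M] [ChartedSpace H M] [IsManifold I ∞ M]
    {E' : Type*} [NormedAddCommGroup E'] [NormedSpace ℝ E']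
    {H' : Type*} [TopologicalSpace H'] {I' : ModelWithCorners ℝ E' H'}
    {M' : Type*} [TopologicalSpace M'] [ChartedSpace H' M']
    {f : M → M'} (hf : ContMDiff I I' ∞ f) (x : M) {y : E} (hy : y ∈ (extChartAt I x).target)
    {F : E → M'} {L : E →L[ℝ] E'}
    (hF : ∀ z ∈ (extChartAt I x).target, f ((extChartAt I x).symm z) = F z)
    (hL : HasMFDerivAt 𝓘(ℝ, E) I' F y L) (v : E) :
    (mfderiv I I' f ((extChartAt I x).symm y)
      (mfderiv 𝓘(ℝ, E) I (extChartAt I x).symm y v) : E') = L v := by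
  have h₁ := ((hf.mdifferentiableAt (x := (extChartAt I x).symm y) (by simp)).hasMFDerivAt.comp y
    (mdifferentiableAt_extChartAt_symm x hy).hasMFDerivAt).mfderiv
  have h₂ := (hL.congr_of_eventuallyEq (f₁ := f ∘ (extChartAt I x).symm) (by
    filter_upwards [(isOpen_extChartAt_target x).mem_nhds hy] with z hz using hF z hz)).mfderiv
  exact congrArg (fun L : E →L[ℝ] E' => L v) (h₁.symm.trans h₂)

theorem bilinField_congr {E : Type*} [NormedAddCommGroup E] [NormedSpace ℝ E]
    {H : Type*} [TopologicalSpace H] {I : ModelWithCorners ℝ E H}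
    {M : Type*} [TopologicalSpace M] [ChartedSpace H M] (g : BilinField I M) {x x' : M}
    (hx : x = x') {v v' w w' : E} (hv : v = v') (hw : w = w') :
    (g x : LinearMap.BilinForm ℝ E) v w = (g x' : LinearMap.BilinForm ℝ E) v' w' := by
  subst hx hv hw; rfl

theorem fderiv_apply_of_eventuallyEq_clm {E F : Type*} [NormedAddCommGroup E] [NormedSpace ℝ E]
    [NormedAddCommGroup F] [NormedSpace ℝ F] {f : E → F} {L : E →L[ℝ] F} {y : E}
    (h : f =ᶠ[𝓝 y] L) (v : E) : fderiv ℝ f y v = L v := by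
  rw [h.fderiv_eq, ContinuousLinearMap.fderiv]

section Ambient

variable {E₁ : Type*} [NormedAddCommGroup E₁] [NormedSpace ℝ E₁] [FiniteDimensional ℝ E₁]
  [Nontrivial E₁]
  {H₁ : Type*} [TopologicalSpace H₁] {I₁ : ModelWithCorners ℝ E₁ H₁} [I₁.Boundaryless]
  {M₁ : Type*} [TopologicalSpace M₁] [ChartedSpace H₁ M₁] [IsManifold I₁ ∞ M₁]
  {E₂ : Type*} [NormedAddCommGroup E₂] [NormedSpace ℝ E₂] [FiniteDimensional ℝ E₂]
  {H₂ : Type*} [TopologicalSpace H₂] {I₂ : ModelWithCorners ℝ E₂ H₂} [I₂.Boundaryless]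
  {M₂ : Type*} [TopologicalSpace M₂] [ChartedSpace H₂ M₂] [IsManifold I₂ ∞ M₂]
  {g₁ : PseudoMetric I₁ M₁} {g₂ : PseudoMetric I₂ M₂} {m₂ : ℕ} {μ : ℝ}

/-! ### Coordinates on the ambient space -/

theorem ambient_extChartAt_apply (z z' : AmbientSpace g₁ g₂ m₂ μ) :
    extChartAt (ambientModel I₁ I₂) z z' =
      (((extChartAt I₁ z.1.base.1 z'.1.base.1, extChartAt I₂ z.1.base.2 z'.1.base.2),
        (z'.1.scale : ℝ)), (z'.2 : ℝ)) := rfl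

theorem mem_ambient_extChartAt_target (z : AmbientSpace g₁ g₂ m₂ μ)
    (y : ((E₁ × E₂) × ℝ) × ℝ) :
    y ∈ (extChartAt (ambientModel I₁ I₂) z).target ↔
      ((y.1.1.1 ∈ (extChartAt I₁ z.1.base.1).target ∧
        y.1.1.2 ∈ (extChartAt I₂ z.1.base.2).target) ∧ 0 < y.1.2) ∧
        y.2 ∈ ambientInterval m₂ μ := by
  rw [extChartAt_prod, PartialEquiv.prod_target, RayBundle.extChartAt_target,
    Opens.extChartAt_target, extChartAt_prod, PartialEquiv.prod_target]
  rfl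

theorem contMDiff_ambient_base₁ :
    ContMDiff (ambientModel I₁ I₂) I₁ ∞ (fun z : AmbientSpace g₁ g₂ m₂ μ => z.1.base.1) :=
  contMDiff_fst.comp (RayBundle.contMDiff_base.comp contMDiff_fst)

theorem contMDiff_ambient_base₂ :
    ContMDiff (ambientModel I₁ I₂) I₂ ∞ (fun z : AmbientSpace g₁ g₂ m₂ μ => z.1.base.2) :=
  contMDiff_snd.comp (RayBundle.contMDiff_base.comp contMDiff_fst)

theorem contMDiff_ambient_t :
    ContMDiff (ambientModel I₁ I₂) 𝓘(ℝ, ℝ) ∞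
      (fun z : AmbientSpace g₁ g₂ m₂ μ => (z.1.scale : ℝ)) :=
  RayBundle.contMDiff_scale_val.comp contMDiff_fst

theorem contMDiff_ambient_rho :
    ContMDiff (ambientModel I₁ I₂) 𝓘(ℝ, ℝ) ∞
      (fun z : AmbientSpace g₁ g₂ m₂ μ => (z.2 : ℝ)) :=
  contMDiff_subtype_val.comp contMDiff_snd

theorem ambient_base₁_symm (z : AmbientSpace g₁ g₂ m₂ μ) (y : ((E₁ × E₂) × ℝ) × ℝ) :
    ((extChartAt (ambientModel I₁ I₂) z).symm y).1.base.1 =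
      (extChartAt I₁ z.1.base.1).symm y.1.1.1 :=
  congrArg Prod.fst (RayBundle.base_extChartAt_symm z.1 y.1)

theorem ambient_base₂_symm (z : AmbientSpace g₁ g₂ m₂ μ) (y : ((E₁ × E₂) × ℝ) × ℝ) :
    ((extChartAt (ambientModel I₁ I₂) z).symm y).1.base.2 =
      (extChartAt I₂ z.1.base.2).symm y.1.1.2 :=
  congrArg Prod.snd (RayBundle.base_extChartAt_symm z.1 y.1)

theorem ambient_t_symm (z : AmbientSpace g₁ g₂ m₂ μ) {y : ((E₁ × E₂) × ℝ) × ℝ}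
    (hy : y ∈ (extChartAt (ambientModel I₁ I₂) z).target) :
    (((extChartAt (ambientModel I₁ I₂) z).symm y).1.scale : ℝ) = y.1.2 :=
  RayBundle.scale_extChartAt_symm z.1 ((mem_ambient_extChartAt_target z y).1 hy).1.2

theorem ambient_rho_symm (z : AmbientSpace g₁ g₂ m₂ μ) {y : ((E₁ × E₂) × ℝ) × ℝ}
    (hy : y ∈ (extChartAt (ambientModel I₁ I₂) z).target) :
    (((extChartAt (ambientModel I₁ I₂) z).symm y).2 : ℝ) = y.2 :=
  congrArg Prod.snd ((extChartAt (ambientModel I₁ I₂) z).right_inv hy)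

theorem ambientMetric_apply (z : AmbientSpace g₁ g₂ m₂ μ)
    (v w : TangentSpace (ambientModel I₁ I₂) z) :
    ambientMetric g₁ g₂ m₂ μ z v w =
      (z.1.scale : ℝ) *
        (mvfderiv (ambientModel I₁ I₂) (fun z : AmbientSpace g₁ g₂ m₂ μ => (z.1.scale : ℝ)) z v *
          mvfderiv (ambientModel I₁ I₂) (fun z : AmbientSpace g₁ g₂ m₂ μ => (z.2 : ℝ)) z w +
        mvfderiv (ambientModel I₁ I₂) (fun z : AmbientSpace g₁ g₂ m₂ μ => (z.2 : ℝ)) z v *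
          mvfderiv (ambientModel I₁ I₂) (fun z : AmbientSpace g₁ g₂ m₂ μ => (z.1.scale : ℝ)) z w)
      + 2 * (z.2 : ℝ) *
        (mvfderiv (ambientModel I₁ I₂) (fun z : AmbientSpace g₁ g₂ m₂ μ => (z.1.scale : ℝ)) z v *
          mvfderiv (ambientModel I₁ I₂) (fun z : AmbientSpace g₁ g₂ m₂ μ => (z.1.scale : ℝ)) z w)
      + (z.1.scale : ℝ) ^ 2 * (1 + μ * z.2) ^ 2 * g₁.val z.1.base.1
          (mfderiv (ambientModel I₁ I₂) I₁ (fun z : AmbientSpace g₁ g₂ m₂ μ => z.1.base.1) z v)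
          (mfderiv (ambientModel I₁ I₂) I₁ (fun z : AmbientSpace g₁ g₂ m₂ μ => z.1.base.1) z w)
      + (z.1.scale : ℝ) ^ 2 * (1 - μ * z.2) ^ 2 * g₂.val z.1.base.2
          (mfderiv (ambientModel I₁ I₂) I₂ (fun z : AmbientSpace g₁ g₂ m₂ μ => z.1.base.2) z v)
          (mfderiv (ambientModel I₁ I₂) I₂ (fun z : AmbientSpace g₁ g₂ m₂ μ => z.1.base.2) z w) := by
  simp only [ambientMetric, symProd, pullback, LinearMap.add_apply, LinearMap.smul_apply,
    LinearMap.BilinForm.linMulLin_apply, LinearMap.compl₁₂_apply, ContinuousLinearMap.coe_coe,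
    smul_eq_mul]
  ring

theorem inChart_ambientMetric (z : AmbientSpace g₁ g₂ m₂ μ) {y : ((E₁ × E₂) × ℝ) × ℝ}
    (hy : y ∈ (extChartAt (ambientModel I₁ I₂) z).target) :
    inChart (ambientMetric g₁ g₂ m₂ μ) z y =
      ambientForm μ (inChart g₁.val z.1.base.1) (inChart g₂.val z.1.base.2) y := by
  obtain ⟨⟨⟨hy₁, hy₂⟩, -⟩, -⟩ := (mem_ambient_extChartAt_target z y).1 hy
  have dt : ∀ v, mvfderiv (ambientModel I₁ I₂)
      (fun z : AmbientSpace g₁ g₂ m₂ μ => (z.1.scale : ℝ)) _ _ = _ :=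
    mfderiv_mfderiv_extChartAt_symm contMDiff_ambient_t z hy
    (fun y hy => ambient_t_symm z hy) (tProj E₁ E₂).hasMFDerivAt
  have dρ : ∀ v, mvfderiv (ambientModel I₁ I₂)
      (fun z : AmbientSpace g₁ g₂ m₂ μ => (z.2 : ℝ)) _ _ = _ :=
    mfderiv_mfderiv_extChartAt_symm contMDiff_ambient_rho z hy
    (fun y hy => ambient_rho_symm z hy) (rhoProj E₁ E₂).hasMFDerivAt
  have d₁ := mfderiv_mfderiv_extChartAt_symm contMDiff_ambient_base₁ z hy
    (fun y _ => ambient_base₁_symm z y)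
    (((mdifferentiableAt_extChartAt_symm (I := I₁) z.1.base.1 hy₁).hasMFDerivAt.comp y
      (fstProj E₁ E₂).hasMFDerivAt))
  have d₂ := mfderiv_mfderiv_extChartAt_symm contMDiff_ambient_base₂ z hy
    (fun y _ => ambient_base₂_symm z y)
    (((mdifferentiableAt_extChartAt_symm (I := I₂) z.1.base.2 hy₂).hasMFDerivAt.comp y
      (sndProj E₁ E₂).hasMFDerivAt))
  refine ContinuousLinearMap.ext fun v => ContinuousLinearMap.ext fun w => ?_
  rw [ambientForm_apply]
  refine (inChart_apply _ _ _ _ _).trans ((ambientMetric_apply _ _ _).trans ?_)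
  have b₁ := bilinField_congr g₁.val (ambient_base₁_symm z y) (d₁ v) (d₁ w)
  have b₂ := bilinField_congr g₂.val (ambient_base₂_symm z y) (d₂ v) (d₂ w)
  rw [dt v, dt w, dρ v, dρ w, ambient_t_symm z hy, ambient_rho_symm z hy]
  exact congrArg₂ (· + ·) (congrArg₂ (· + ·) rfl (congrArg (_ * ·) b₁)) (congrArg (_ * ·) b₂)

theorem ambientMetric_eq_ambientForm (z : AmbientSpace g₁ g₂ m₂ μ)
    (v w : ((E₁ × E₂) × ℝ) × ℝ) :
    ambientMetric g₁ g₂ m₂ μ z v w =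
      ambientForm μ (inChart g₁.val z.1.base.1) (inChart g₂.val z.1.base.2)
        (extChartAt (ambientModel I₁ I₂) z z) v w := by
  rw [← inChart_ambientMetric z (mem_extChartAt_target z)]
  exact (inChart_self _ z v w).symm

theorem one_add_ne_zero_of_mem_ambientInterval {ρ : ℝ} (h : ρ ∈ ambientInterval m₂ μ) :
    1 + μ * ρ ≠ 0 := by
  intro h₀
  have hμ : μ ≠ 0 := by rintro rfl; simp at h₀
  have e : ρ = -1 / μ := by field_simp; linarith
  unfold ambientInterval at h
  rw [if_neg hμ] at h
  split_ifs at h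
  · exact h e
  · exact h (Or.inr e)

theorem one_sub_ne_zero_of_mem_ambientInterval (hm : m₂ ≠ 0) {ρ : ℝ}
    (h : ρ ∈ ambientInterval m₂ μ) : 1 - μ * ρ ≠ 0 := by
  intro h₀
  have hμ : μ ≠ 0 := by rintro rfl; simp at h₀
  have e : ρ = 1 / μ := by field_simp; linarith
  unfold ambientInterval at h
  rw [if_neg hμ, if_neg hm] at h
  exact h (Or.inl e)

theorem isRegularPoint_of_mem_target (hm : m₂ = 0 → Subsingleton E₂)
    (z : AmbientSpace g₁ g₂ m₂ μ) {y : ((E₁ × E₂) × ℝ) × ℝ}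
    (hy : y ∈ (extChartAt (ambientModel I₁ I₂) z).target) :
    IsRegularPoint μ (inChart g₁.val z.1.base.1) (inChart g₂.val z.1.base.2) y := by
  obtain ⟨⟨⟨hy₁, hy₂⟩, ht⟩, hρ⟩ := (mem_ambient_extChartAt_target z y).1 hy
  refine ⟨g₁.isPseudoMetric.isMetricNear _ hy₁, g₂.isPseudoMetric.isMetricNear _ hy₂, ht.ne',
    one_add_ne_zero_of_mem_ambientInterval hρ, ?_⟩
  by_cases h : m₂ = 0
  · exact Or.inr (hm h)
  · exact Or.inl (one_sub_ne_zero_of_mem_ambientInterval h hρ)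

/-! ### The explicit metric is an ambient metric -/

theorem isPseudoMetric_ambientMetric (hm : m₂ = 0 → Subsingleton E₂) :
    IsPseudoMetric (ambientMetric g₁ g₂ m₂ μ) where
  symm z v w := by
    have h := (isRegularPoint_of_mem_target hm z (mem_extChartAt_target z)).isMetricNear
    exact (ambientMetric_eq_ambientForm z v w).trans
      ((h.symm.self_of_nhds v w).trans (ambientMetric_eq_ambientForm z w v).symm)
  nondegenerate z v hv := by
    have h := (isRegularPoint_of_mem_target hm z (mem_extChartAt_target z)).isMetricNear
    exact h.nondegenerate.self_of_nhds v fun w =>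
      (ambientMetric_eq_ambientForm z v w).symm.trans (hv w)
  smooth z := by
    refine (contDiffOn_ambientForm (g₁.isPseudoMetric.smooth z.1.base.1)
      (g₂.isPseudoMetric.smooth z.1.base.2) ?_ ?_).congr fun y hy => inChart_ambientMetric z hy
    · exact fun y hy => ((mem_ambient_extChartAt_target z y).1 hy).1.1.1
    · exact fun y hy => ((mem_ambient_extChartAt_target z y).1 hy).1.1.2

theorem hasSignature_ambientMetric (hm : m₂ = 0 → Subsingleton E₂) {p₁ q₁ p₂ q₂ : ℕ}
    (h₁ : HasSignature g₁.val p₁ q₁) (h₂ : HasSignature g₂.val p₂ q₂) :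
    HasSignature (ambientMetric g₁ g₂ m₂ μ) (p₁ + p₂ + 1) (q₁ + q₂ + 1) := by
  intro z
  have hz := isRegularPoint_of_mem_target hm z (mem_extChartAt_target z)
  rw [← (h₁ z.1.base.1).1, ← (h₁ z.1.base.1).2, ← (h₂ z.1.base.2).1, ← (h₂ z.1.base.2).2]
  let B₁ : LinearMap.BilinForm ℝ E₁ := g₁.val z.1.base.1
  let B₂ : LinearMap.BilinForm ℝ E₂ := g₂.val z.1.base.2
  let B : LinearMap.BilinForm ℝ (((E₁ × E₂) × ℝ) × ℝ) := ambientMetric g₁ g₂ m₂ μ z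
  refine sigPos_sigNeg_of_sum B₁ B₂ B
    (g₁.isPseudoMetric.symm _) (g₁.isPseudoMetric.nondegenerate _)
    (g₂.isPseudoMetric.symm _) (g₂.isPseudoMetric.nondegenerate _)
    (t := z.1.scale) (ρ := z.2) (a₁ := (z.1.scale : ℝ) ^ 2 * (1 + μ * z.2) ^ 2)
    (a₂ := (z.1.scale : ℝ) ^ 2 * (1 - μ * z.2) ^ 2) hz.t_ne ?_ ?_ ?_
  · exact mul_pos (sq_pos_of_ne_zero hz.t_ne) (sq_pos_of_ne_zero hz.fst_ne)
  · exact hz.snd_ne.imp_left fun h => mul_pos (sq_pos_of_ne_zero hz.t_ne) (sq_pos_of_ne_zero h)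
  · intro v
    refine (ambientMetric_eq_ambientForm z v v).trans ((ambientForm_apply _ _ _ _ _ _).trans ?_)
    refine (congrArg₂ (· + ·) (congrArg₂ (· + ·) ?_ (congrArg (_ * ·) (inChart_self _ _ _ _)))
      (congrArg (_ * ·) (inChart_self _ _ _ _)))
    change (z.1.scale : ℝ) * (v.1.2 * v.2 + v.2 * v.1.2) + 2 * (z.2 : ℝ) * (v.1.2 * v.1.2) = _
    ring

theorem ricci_ambientMetric (hm : m₂ = 0 → Subsingleton E₂)
    (hE₁ : IsEinstein g₁.val) (hE₂ : IsEinstein g₂.val)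
    (hμ₁ : ∀ x, 2 * (Module.finrank ℝ E₁ : ℝ) * (Module.finrank ℝ E₁ - 1) * μ =
      scalarCurvature g₁.val x)
    (hμ₂ : ∀ x, 2 * (Module.finrank ℝ E₂ : ℝ) * (Module.finrank ℝ E₂ - 1) * μ =
      -scalarCurvature g₂.val x) (z : AmbientSpace g₁ g₂ m₂ μ) :
    ricci (ambientMetric g₁ g₂ m₂ μ) z = 0 := by
  have hy := mem_extChartAt_target (I := ambientModel I₁ I₂) z
  have hz := isRegularPoint_of_mem_target hm z hy
  have he : inChart (ambientMetric g₁ g₂ m₂ μ) z =ᶠ[𝓝 (extChartAt (ambientModel I₁ I₂) z z)]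
      ambientForm μ (inChart g₁.val z.1.base.1) (inChart g₂.val z.1.base.2) := by
    filter_upwards [(isOpen_extChartAt_target z).mem_nhds hy] with y hy
      using inChart_ambientMetric z hy
  refine (ricciLocal_congr he).trans (hz.ricciLocal_eq_zero (fun v w => ?_) fun v w => ?_)
  · have := hE₁.finrank_mul_ricci g₁.isPseudoMetric z.1.base.1 v w
    rw [← hμ₁] at this
    have hn : (Module.finrank ℝ E₁ : ℝ) ≠ 0 := Nat.cast_ne_zero.2 Module.finrank_pos.ne'
    refine mul_left_cancel₀ hn (this.trans ?_)
    change _ = (Module.finrank ℝ E₁ : ℝ) * (2 * (Module.finrank ℝ E₁ - 1) * μ *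
      inChart g₁.val z.1.base.1 (extChartAt I₁ z.1.base.1 z.1.base.1) v w)
    ring
  · rcases subsingleton_or_nontrivial E₂ with h | h
    · simp [Subsingleton.elim v 0]
    have := hE₂.finrank_mul_ricci g₂.isPseudoMetric z.1.base.2 v w
    rw [← neg_neg (scalarCurvature _ _), ← hμ₂] at this
    have hn : (Module.finrank ℝ E₂ : ℝ) ≠ 0 := Nat.cast_ne_zero.2 Module.finrank_pos.ne'
    refine mul_left_cancel₀ hn (this.trans ?_)
    change _ = (Module.finrank ℝ E₂ : ℝ) * -(2 * (Module.finrank ℝ E₂ - 1) * μ *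
      inChart g₂.val z.1.base.2 (extChartAt I₂ z.1.base.2 z.1.base.2) v w)
    ring

theorem vectorInChart_fundamentalField (z : AmbientSpace g₁ g₂ m₂ μ)
    {y : ((E₁ × E₂) × ℝ) × ℝ} (hy : y ∈ (extChartAt (ambientModel I₁ I₂) z).target) :
    vectorInChart (fundamentalField (ambientModel I₁ I₂) (ambientAction g₁ g₂ m₂ μ)) z y =
      (((0, 0), y.1.2), 0) := by
  set u := (extChartAt (ambientModel I₁ I₂) z).symm y with hu
  have husrc : u ∈ (extChartAt (ambientModel I₁ I₂) z).source :=
    (extChartAt (ambientModel I₁ I₂) z).map_target hy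
  let c : ℝ → AmbientSpace g₁ g₂ m₂ μ := fun s =>
    ambientAction g₁ g₂ m₂ μ ⟨Real.exp s, Real.exp_pos s⟩ u
  have hc0 : c 0 = u := by
    refine Prod.ext (RayBundle.ext_base_scale rfl ((RayBundle.scale_dilate _ u.1).trans ?_)) rfl
    exact Subtype.ext (by change Real.exp 0 * _ = _; rw [Real.exp_zero, one_mul])
  have hexp : ContMDiff 𝓘(ℝ, ℝ) 𝓘(ℝ, ℝ) ∞
      (fun s : ℝ => (⟨Real.exp s, Real.exp_pos s⟩ : PosReal)) := by
    intro s
    have hi : Manifold.IsImmersionAt 𝓘(ℝ, ℝ) 𝓘(ℝ, ℝ) ∞ (fun s : PosReal => (s : ℝ))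
        ⟨Real.exp s, Real.exp_pos s⟩ :=
      Manifold.IsImmersionAt.of_opens (⟨Ioi 0, isOpen_Ioi⟩ : Opens ℝ) (Real.exp_pos s)
    exact (ContMDiffAt.iff_comp_isImmersionAt
      (f := fun s : ℝ => (⟨Real.exp s, Real.exp_pos s⟩ : PosReal)) hi).2
      ⟨(Real.continuous_exp.subtype_mk _).continuousAt, Real.contDiff_exp.contMDiff s⟩
  have hcs : ContMDiff 𝓘(ℝ, ℝ) (ambientModel I₁ I₂) ∞ c :=
    (RayBundle.contMDiff_dilate.comp (hexp.prodMk contMDiff_const)).prodMk contMDiff_const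
  have : IsManifold (ambientModel I₁ I₂) 1 (AmbientSpace g₁ g₂ m₂ μ) :=
    IsManifold.of_le (n := ∞) (by norm_cast)
  have hφ : MDifferentiableAt (ambientModel I₁ I₂) 𝓘(ℝ, ((E₁ × E₂) × ℝ) × ℝ)
      (extChartAt (ambientModel I₁ I₂) z) (c 0) := by
    rw [hc0]
    exact mdifferentiableAt_extChartAt (by simpa using husrc)
  have h₁ := (hφ.hasMFDerivAt.comp (0 : ℝ)
    (hcs.mdifferentiableAt (by simp)).hasMFDerivAt).mfderiv
  have h₂ : (extChartAt (ambientModel I₁ I₂) z) ∘ c =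
      fun s : ℝ => ((y.1.1, Real.exp s * y.1.2), y.2) := by
    funext s
    have hy' := (extChartAt (ambientModel I₁ I₂) z).right_inv hy
    rw [← hu, ambient_extChartAt_apply] at hy'
    refine (ambient_extChartAt_apply z (c s)).trans ?_
    have hs : ((c s).1.scale : ℝ) = Real.exp s * u.1.scale :=
      congrArg Subtype.val (RayBundle.scale_dilate _ u.1)
    rw [hs, ← hy']
    rfl
  have h₃ : HasDerivAt (fun s : ℝ => ((y.1.1, Real.exp s * y.1.2), y.2))
      (((0, 0), y.1.2), 0) 0 := by
    have := (((hasDerivAt_const (0 : ℝ) y.1.1).prodMk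
      ((Real.hasDerivAt_exp 0).mul_const y.1.2)).prodMk (hasDerivAt_const (0 : ℝ) y.2))
    simpa using! this
  have h₄ : (mfderiv 𝓘(ℝ, ℝ) 𝓘(ℝ, ((E₁ × E₂) × ℝ) × ℝ)
      ((extChartAt (ambientModel I₁ I₂) z) ∘ c) 0 (1 : ℝ) : ((E₁ × E₂) × ℝ) × ℝ) =
      (((0, 0), y.1.2), 0) := by
    rw [h₂, mfderiv_eq_fderiv]
    exact h₃.deriv
  rw [h₁] at h₄
  refine Eq.trans ?_ h₄
  exact congrArg (fun p : AmbientSpace g₁ g₂ m₂ μ =>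
    (mfderiv (ambientModel I₁ I₂) 𝓘(ℝ, ((E₁ × E₂) × ℝ) × ℝ) (extChartAt (ambientModel I₁ I₂) z) p :
      ((E₁ × E₂) × ℝ) × ℝ →L[ℝ] ((E₁ × E₂) × ℝ) × ℝ)
      (mfderiv 𝓘(ℝ, ℝ) (ambientModel I₁ I₂) c 0 (1 : ℝ) : ((E₁ × E₂) × ℝ) × ℝ)) hc0.symm

theorem lieDerivative_ambientMetric (hm : m₂ = 0 → Subsingleton E₂)
    (z : AmbientSpace g₁ g₂ m₂ μ) (v w : TangentSpace (ambientModel I₁ I₂) z) :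
    lieDerivative (fundamentalField (ambientModel I₁ I₂) (ambientAction g₁ g₂ m₂ μ))
      (ambientMetric g₁ g₂ m₂ μ) z v w = 2 * ambientMetric g₁ g₂ m₂ μ z v w := by
  have hy := mem_extChartAt_target (I := ambientModel I₁ I₂) z
  have hz := isRegularPoint_of_mem_target hm z hy
  set y := extChartAt (ambientModel I₁ I₂) z z with hydef
  have hG : inChart (ambientMetric g₁ g₂ m₂ μ) z =ᶠ[𝓝 y]
      ambientForm μ (inChart g₁.val z.1.base.1) (inChart g₂.val z.1.base.2) := by
    filter_upwards [(isOpen_extChartAt_target z).mem_nhds hy] with y hy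
      using inChart_ambientMetric z hy
  have hX : vectorInChart (fundamentalField (ambientModel I₁ I₂) (ambientAction g₁ g₂ m₂ μ)) z
      =ᶠ[𝓝 y] ((ContinuousLinearMap.inl ℝ ((E₁ × E₂) × ℝ) ℝ).comp
        (ContinuousLinearMap.inr ℝ (E₁ × E₂) ℝ)).comp (tProj E₁ E₂) := by
    filter_upwards [(isOpen_extChartAt_target z).mem_nhds hy] with y hy
      using vectorInChart_fundamentalField z hy
  have hD : ∀ v : ((E₁ × E₂) × ℝ) × ℝ, fderiv ℝ (vectorInChart
      (fundamentalField (ambientModel I₁ I₂) (ambientAction g₁ g₂ m₂ μ)) z) y v =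
      (((0, 0), v.1.2), 0) := by
    intro v
    exact fderiv_apply_of_eventuallyEq_clm hX v
  have key : ∀ v w : ((E₁ × E₂) × ℝ) × ℝ,
      fderiv ℝ (inChart (ambientMetric g₁ g₂ m₂ μ) z) y (((0, 0), y.1.2), 0) v w
      + inChart (ambientMetric g₁ g₂ m₂ μ) z y (((0, 0), v.1.2), 0) w
      + inChart (ambientMetric g₁ g₂ m₂ μ) z y v (((0, 0), w.1.2), 0) =
      2 * ambientForm μ (inChart g₁.val z.1.base.1) (inChart g₂.val z.1.base.2) y v w := by
    intro v w
    rw [hG.fderiv_eq, hG.eq_of_nhds, hz.fderiv_ambientForm, ambientForm_apply, ambientForm_apply,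
      ambientForm_apply]
    simp only [map_zero, _root_.zero_apply]
    ring
  have e := key v w
  rw [← hD v, ← hD w, ← vectorInChart_fundamentalField z hy] at e
  exact e.trans (congrArg (2 * ·) (ambientMetric_eq_ambientForm z v w).symm)

theorem ambientMetric_inclusion (u : RayBundle (g₁.prod g₂))
    (ξ η : TangentSpace ((I₁.prod I₂).prod 𝓘(ℝ, ℝ)) u) :
    ambientMetric g₁ g₂ m₂ μ (ambientInclusion g₁ g₂ m₂ μ u)
      (mfderiv ((I₁.prod I₂).prod 𝓘(ℝ, ℝ)) (ambientModel I₁ I₂)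
        (ambientInclusion g₁ g₂ m₂ μ) u ξ)
      (mfderiv ((I₁.prod I₂).prod 𝓘(ℝ, ℝ)) (ambientModel I₁ I₂)
        (ambientInclusion g₁ g₂ m₂ μ) u η) =
      u.form (mfderiv ((I₁.prod I₂).prod 𝓘(ℝ, ℝ)) (I₁.prod I₂) RayBundle.base u ξ)
        (mfderiv ((I₁.prod I₂).prod 𝓘(ℝ, ℝ)) (I₁.prod I₂) RayBundle.base u η) := by
  have hi : MDifferentiableAt ((I₁.prod I₂).prod 𝓘(ℝ, ℝ)) (ambientModel I₁ I₂)
      (ambientInclusion g₁ g₂ m₂ μ) u :=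
    mdifferentiableAt_id.prodMk mdifferentiableAt_const
  have hb : MDifferentiableAt ((I₁.prod I₂).prod 𝓘(ℝ, ℝ)) (I₁.prod I₂)
      (RayBundle.base : RayBundle (g₁.prod g₂) → M₁ × M₂) u :=
    RayBundle.contMDiff_base.mdifferentiableAt (by simp)
  have dρ : ∀ ξ, mvfderiv (ambientModel I₁ I₂) (fun z : AmbientSpace g₁ g₂ m₂ μ => (z.2 : ℝ))
      (ambientInclusion g₁ g₂ m₂ μ u) (mfderiv ((I₁.prod I₂).prod 𝓘(ℝ, ℝ)) (ambientModel I₁ I₂)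
        (ambientInclusion g₁ g₂ m₂ μ) u ξ) = 0 := by
    intro ξ
    have h := ((contMDiff_ambient_rho.mdifferentiableAt
      (x := ambientInclusion g₁ g₂ m₂ μ u) (by simp)).hasMFDerivAt.comp u hi.hasMFDerivAt).mfderiv
    have h₀ : (fun z : AmbientSpace g₁ g₂ m₂ μ => (z.2 : ℝ)) ∘ ambientInclusion g₁ g₂ m₂ μ =
        fun _ => (0 : ℝ) := rfl
    rw [h₀, mfderiv_const] at h
    exact (congrArg (fun L : (E₁ × E₂) × ℝ →L[ℝ] ℝ => L ξ) h).symm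
  have d₁ : ∀ ξ, (mfderiv (ambientModel I₁ I₂) I₁
      (fun z : AmbientSpace g₁ g₂ m₂ μ => z.1.base.1) (ambientInclusion g₁ g₂ m₂ μ u)
      (mfderiv ((I₁.prod I₂).prod 𝓘(ℝ, ℝ)) (ambientModel I₁ I₂)
        (ambientInclusion g₁ g₂ m₂ μ) u ξ) : E₁) =
      (mfderiv ((I₁.prod I₂).prod 𝓘(ℝ, ℝ)) (I₁.prod I₂) RayBundle.base u ξ : E₁ × E₂).1 := by
    intro ξ
    have h := ((contMDiff_ambient_base₁.mdifferentiableAt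
      (x := ambientInclusion g₁ g₂ m₂ μ u) (by simp)).hasMFDerivAt.comp u hi.hasMFDerivAt).mfderiv
    have h' := (mdifferentiableAt_fst.hasMFDerivAt.comp u hb.hasMFDerivAt).mfderiv
    rw [mfderiv_fst] at h'
    exact congrArg (fun L : (E₁ × E₂) × ℝ →L[ℝ] E₁ => L ξ) (h.symm.trans h')
  have d₂ : ∀ ξ, (mfderiv (ambientModel I₁ I₂) I₂
      (fun z : AmbientSpace g₁ g₂ m₂ μ => z.1.base.2) (ambientInclusion g₁ g₂ m₂ μ u)
      (mfderiv ((I₁.prod I₂).prod 𝓘(ℝ, ℝ)) (ambientModel I₁ I₂)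
        (ambientInclusion g₁ g₂ m₂ μ) u ξ) : E₂) =
      (mfderiv ((I₁.prod I₂).prod 𝓘(ℝ, ℝ)) (I₁.prod I₂) RayBundle.base u ξ : E₁ × E₂).2 := by
    intro ξ
    have h := ((contMDiff_ambient_base₂.mdifferentiableAt
      (x := ambientInclusion g₁ g₂ m₂ μ u) (by simp)).hasMFDerivAt.comp u hi.hasMFDerivAt).mfderiv
    have h' := (mdifferentiableAt_snd.hasMFDerivAt.comp u hb.hasMFDerivAt).mfderiv
    rw [mfderiv_snd] at h'
    exact congrArg (fun L : (E₁ × E₂) × ℝ →L[ℝ] E₂ => L ξ) (h.symm.trans h')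
  rw [ambientMetric_apply, dρ ξ, dρ η, u.form_eq]
  have b₁ := bilinField_congr g₁.val (rfl : u.base.1 = u.base.1) (d₁ ξ) (d₁ η)
  have b₂ := bilinField_congr g₂.val (rfl : u.base.2 = u.base.2) (d₂ ξ) (d₂ η)
  refine (congrArg₂ (· + ·) (congrArg₂ (· + ·) rfl (congrArg (_ * ·) b₁))
    (congrArg (_ * ·) b₂)).trans (Eq.trans ?_ (congrArg ((u.scale : ℝ) ^ 2 * ·)
      (prodField_apply g₁.val g₂.val u.base _ _).symm))
  simp only [ambientInclusion]
  ring

theorem isAmbientMetric (hm : m₂ = 0 → Subsingleton E₂) {p₁ q₁ p₂ q₂ : ℕ}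
    (h₁ : HasSignature g₁.val p₁ q₁) (h₂ : HasSignature g₂.val p₂ q₂) :
    IsAmbientMetric (ambientModel I₁ I₂) (g₁.prod g₂) (p₁ + p₂) (q₁ + q₂)
      (ambientAction g₁ g₂ m₂ μ) (ambientInclusion g₁ g₂ m₂ μ) (ambientMetric g₁ g₂ m₂ μ) where
  isPseudoMetric := isPseudoMetric_ambientMetric hm
  hasSignature := hasSignature_ambientMetric hm h₁ h₂
  homogeneous := lieDerivative_ambientMetric hm
  tautological := ambientMetric_inclusion

theorem isAmbientManifold :
    IsAmbientManifold (ambientModel I₁ I₂) (g₁.prod g₂) (ambientAction g₁ g₂ m₂ μ)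
      (ambientInclusion g₁ g₂ m₂ μ) where
  finrank_eq := by simp [Module.finrank_prod]
  one_act u := Prod.ext (RayBundle.ext_base_scale rfl
    ((RayBundle.scale_dilate 1 u.1).trans (one_mul _))) rfl
  mul_act s s' u := Prod.ext (RayBundle.ext_base_scale rfl
    ((RayBundle.scale_dilate (s * s') u.1).trans
      ((mul_assoc _ _ _).trans ((RayBundle.scale_dilate s _).trans
        (congrArg (s * ·) (RayBundle.scale_dilate s' u.1))).symm))) rfl
  free s u h := by
    have := (RayBundle.scale_dilate s u.1).symm.trans
      (congrArg (fun z : AmbientSpace g₁ g₂ m₂ μ => z.1.scale) h)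
    exact mul_eq_right.1 this
  smooth_act := (RayBundle.contMDiff_dilate.comp
      (contMDiff_fst.prodMk (contMDiff_fst.comp contMDiff_snd))).prodMk
    (contMDiff_snd.comp contMDiff_snd)
  embedding := isSmoothEmbedding_prodMk_const _ rfl
  equivariant s u := rfl

end Ambient

end AmbientGeometry

end

theorem theorem2p1 (m₁ m₂ : ℕ) [NeZero m₁]
    {M₁ : Type*} [TopologicalSpace M₁] [ChartedSpace (EuclideanSpace ℝ (Fin m₁)) M₁]
    [IsManifold (𝓡 m₁) ∞ M₁]
    {M₂ : Type*} [TopologicalSpace M₂] [ChartedSpace (EuclideanSpace ℝ (Fin m₂)) M₂]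
    [IsManifold (𝓡 m₂) ∞ M₂]
    (g₁ : PseudoMetric (𝓡 m₁) M₁)
    (g₂ : PseudoMetric (𝓡 m₂) M₂)
    (p₁ q₁ p₂ q₂ : ℕ) (hsig₁ : HasSignature g₁.val p₁ q₁) (hsig₂ : HasSignature g₂.val p₂ q₂)
    (hE₁ : IsEinstein g₁.val) (hE₂ : IsEinstein g₂.val)
    (hSc : ∀ x₁ x₂, (m₂ : ℝ) * (m₂ - 1) * scalarCurvature g₁.val x₁ =
      -((m₁ : ℝ) * (m₁ - 1) * scalarCurvature g₂.val x₂))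
    (μ : ℝ) (hμ₁ : ∀ x, 2 * (m₁ : ℝ) * (m₁ - 1) * μ = scalarCurvature g₁.val x)
    (hμ₂ : ∀ x, 2 * (m₂ : ℝ) * (m₂ - 1) * μ = -scalarCurvature g₂.val x) :
    IsAmbientManifold (ambientModel (𝓡 m₁) (𝓡 m₂))
      (g₁.prod g₂) (ambientAction g₁ g₂ m₂ μ) (ambientInclusion g₁ g₂ m₂ μ) ∧
    IsAmbientMetric (ambientModel (𝓡 m₁) (𝓡 m₂))
      (g₁.prod g₂) (p₁ + p₂) (q₁ + q₂) (ambientAction g₁ g₂ m₂ μ)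
      (ambientInclusion g₁ g₂ m₂ μ) (ambientMetric g₁ g₂ m₂ μ) ∧
    ∀ z, ricci (ambientMetric g₁ g₂ m₂ μ) z = 0 := by
  have hm : m₂ = 0 → Subsingleton (EuclideanSpace ℝ (Fin m₂)) := by
    rintro rfl
    infer_instance
  refine ⟨isAmbientManifold, isAmbientMetric hm hsig₁ hsig₂, ricci_ambientMetric hm hE₁ hE₂ ?_ ?_⟩
  · simpa only [finrank_euclideanSpace_fin] using hμ₁
  · simpa only [finrank_euclideanSpace_fin] using hμ₂
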